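/- Let $d\ge 1$, $\tau>0$, $T>0$, $c>0$. Let $C$ be a random closed set in $\mathbb{R}^d$ with $C\subset B_{0,\tau}$ (the closed ball of radius $\tau$ centred at the origin) and $\|C\|>0$ almost surely, where $\|\cdot\|$ is Lebesgue measure, and let $\beta=\mathbb{E}\|C\|$. For $\lambda>0$, $\delta>0$ and rates $\mu_0,\mu_1\ge 0$ with $\gamma=\mu_0+\mu_1>0$, consider the scaled Markov–Poisson–Boolean model $\mathcal{C}_t(\delta,\lambda)=\{Y_i^t(X_i+\delta C_i):i\ge1\}$: the $X_i$ are the points of a stationary Poisson process of intensity $\lambda$ in $\mathbb{R}^d$; the $C_i$ are i.i.d. copies of $C$; the $Y_i=(Y_i^t)_{t\ge0}$ are i.i.d. stationary continuous-time Markov processes with values in $\{0,1\}$, jumping from $0$ to $1$ at rate $\mu_0$ and from $1$ to $0$ at rate $\mu_1$, with almost surely right-continuous paths; and points, shapes and on/off processes are independent. A target is at $\underline{s}=(cs,0,\dots,0)\in\mathbb{R}^d$ at time $s$. Let $\zeta(s)=1$ if $\underline{s}\in X_i+\delta C_i$ for some $i$ with $Y_i^s=1$, and $\zeta(s)=0$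 otherwise, and let $$V_T=V_T(\delta)=\int_0^T(1-\zeta(s))\,ds$$ be the uncovered time, which is a well-defined bounded random variable. Let $\lambda\to\infty$, $\delta\to0$, with rates $\mu_0(\delta),\mu_1(\delta)$ and $\gamma(\delta)=\mu_0(\delta)+\mu_1(\delta)$, in such a way that $\delta^d\lambda\to\rho\in[0,\infty)$, $\delta\gamma(\delta)\to a_0\in[0,\infty]$, and the stationary on-probability $\mu_0(\delta)/\gamma(\delta)$ converges to $p_1$ (in particular it may be constantly equal to $p_1$). Put $p_0=1-p_1$. Then $$\mathbb{E}V_T\to Te^{-p_1\rho\beta},\qquad \mathbb{E}\,|V_T-\mathbb{E}V_T|^{p}\to0\quad\text{for every } 1\le p<\infty,$$ $$\delta^{-1}\operatorname{Var}V_T(\delta)\to\sigma_1^2(a_0):=2Te^{-2p_1\rho\beta}\int_0^{2\tau/c}\Bigl(e^{p_1\rho\,\mathbb{E}\|(\underline{s}+C)\cap C\|\,(p_1+p_0e^{-a_0s})}-1\Bigr)\,ds,$$ where $e^{-a_0s}$ is read as $0$ if $a_0=\infty$. -/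

import Mathlib

open MeasureTheory ProbabilityTheory Filter Topology
open TopologicalSpace (Closeds)
open scoped NNReal ENNReal Pointwise

/-- The Euclidean space `ℝᵈ`. -/
abbrev Space (d : ℕ) : Type := EuclideanSpace ℝ (Fin d)

/-- The Fell (hit-or-miss) σ-algebra on the closed subsets of `E`, generated by the families
of closed sets that hit a given compact set. A random closed set is a random element of
`Closeds E` for this σ-algebra. -/
instance closedsMeasurableSpace (E : Type*) [TopologicalSpace E] : MeasurableSpace (Closeds E) :=
  MeasurableSpace.generateFrom
    {A | ∃ K : Set E, IsCompact K ∧ A = {F : Closeds E | ((F : Set E) ∩ K).Nonempty}}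

noncomputable section

/-- The number of points of the sequence `X` that lie in `B`. -/
def pointCount {d : ℕ} {Ω : Type*} (X : ℕ → Ω → Space d) (B : Set (Space d)) (ω : Ω) : ℕ∞ :=
  {n : ℕ | X n ω ∈ B}.encard

/-- The points `X 0, X 1, …` form a stationary (homogeneous) Poisson point process of
intensity `lam` in `ℝᵈ`. -/
structure IsStationaryPoisson {d : ℕ} {Ω : Type*} [MeasurableSpace Ω] (P : Measure Ω)
    (lam : ℝ) (X : ℕ → Ω → Space d) : Prop where
  measurable : ∀ n, Measurable (X n)
  map_count : ∀ B : Set (Space d), MeasurableSet B → volume B ≠ ∞ →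
    P.map (pointCount X B) =
      (poissonMeasure (lam * volume.real B).toNNReal).map (fun k : ℕ => (k : ℕ∞))
  indep_count : ∀ (m : ℕ) (B : Fin m → Set (Space d)), (∀ k, MeasurableSet (B k)) →
    Pairwise (fun k l => Disjoint (B k) (B l)) →
    iIndepFun (fun k => pointCount X (B k)) P

/-- The generator of the chain on `{0, 1}` that jumps from `0` to `1` at rate `μ₀` and from
`1` to `0` at rate `μ₁`. -/
def generator (μ₀ μ₁ : ℝ) : Matrix (Fin 2) (Fin 2) ℝ :=
  !![-μ₀, μ₀; μ₁, -μ₁]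

/-- The transition matrix over a time `t` of the chain with rates `μ₀`, `μ₁`. -/
def transition (μ₀ μ₁ t : ℝ) : Matrix (Fin 2) (Fin 2) ℝ :=
  NormedSpace.exp (t • generator μ₀ μ₁)

/-- `Y` is a stationary continuous-time Markov (jump) process with values in `{0, 1}` and
transition rates `μ₀` (from `0` to `1`) and `μ₁` (from `1` to `0`). -/
structure IsStationaryOnOff {Ω : Type*} [MeasurableSpace Ω] (P : Measure Ω)
    (μ₀ μ₁ : ℝ) (Y : ℝ≥0 → Ω → Fin 2) : Prop where
  measurable : ∀ t, Measurable (Y t)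
  /-- Almost every path is right-continuous, that is, constant on a right neighbourhood of each
  time. -/
  right_cont : ∀ᵐ ω ∂P, ∀ t, ∀ᶠ s in 𝓝[>] t, Y s ω = Y t ω
  stationary : ∀ t j, P.real {ω | Y t ω = j} = P.real {ω | Y 0 ω = j}
  /-- The Markov property: given `Y s = j` and the values at finitely many earlier times, the
  probability of `Y t = k` is `transition μ₀ μ₁ (t - s) j k`. -/
  markov : ∀ (m : ℕ) (u : Fin m → ℝ≥0) (a : Fin m → Fin 2) (s t : ℝ≥0),
    (∀ i, u i ≤ s) → s ≤ t → ∀ j k : Fin 2,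
    P.real {ω | (∀ i, Y (u i) ω = a i) ∧ Y s ω = j ∧ Y t ω = k} =
      P.real {ω | (∀ i, Y (u i) ω = a i) ∧ Y s ω = j} *
        transition μ₀ μ₁ ((t : ℝ) - (s : ℝ)) j k

/-- The randomness of the Markov-Poisson-Boolean model: sensor locations `X n` forming a
stationary Poisson process of intensity `lam`, independent of the i.i.d. marks
`(C n, Y n)`, where the shape `C n` is a random closed set of law `Q` and, independently of it,
the on/off process `Y n` is a stationary two-state Markov process of rates `μ₀`, `μ₁`. -/
structure IsMarkovPoissonBoolean {d : ℕ} {Ω : Type*} [MeasurableSpace Ω] (P : Measure Ω)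
    (lam : ℝ) (Q : Measure (Closeds (Space d))) (μ₀ μ₁ : ℝ)
    (X : ℕ → Ω → Space d) (C : ℕ → Ω → Closeds (Space d)) (Y : ℕ → ℝ≥0 → Ω → Fin 2) :
    Prop where
  poisson : IsStationaryPoisson P lam X
  shape_measurable : ∀ n, Measurable (C n)
  shape_law : ∀ n, P.map (C n) = Q
  onOff : ∀ n, IsStationaryOnOff P μ₀ μ₁ (Y n)
  indep_shape_onOff : ∀ n, IndepFun (C n) (fun ω (t : ℝ≥0) => Y n t ω) P
  indep_marks : iIndepFun (fun n ω => (C n ω, fun t : ℝ≥0 => Y n t ω)) P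
  indep_points : IndepFun (fun ω n => X n ω)
    (fun ω n => (C n ω, fun t : ℝ≥0 => Y n t ω)) P

/-- The point `(c s, 0, …, 0)` of the path, the position of the target at time `s`. -/
def pathPoint (d : ℕ) [NeZero d] (c s : ℝ) : Space d :=
  EuclideanSpace.single 0 (c * s)

/-- At time `s` the target lies in the scaled set `X n + δ C n` of some sensor `n` that is on. -/
def IsCovered {d : ℕ} [NeZero d] {Ω : Type*} (c δ : ℝ) (X : ℕ → Ω → Space d)
    (C : ℕ → Ω → Closeds (Space d)) (Y : ℕ → ℝ≥0 → Ω → Fin 2) (ω : Ω) (s : ℝ) : Prop :=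
  ∃ n, Y n s.toNNReal ω = 1 ∧ pathPoint d c s ∈ X n ω +ᵥ δ • (C n ω : Set (Space d))

open Classical in
/-- The indicator `ζ(s)` of the target being covered at time `s`. -/
def coverIndicator {d : ℕ} [NeZero d] {Ω : Type*} (c δ : ℝ) (X : ℕ → Ω → Space d)
    (C : ℕ → Ω → Closeds (Space d)) (Y : ℕ → ℝ≥0 → Ω → Fin 2) (ω : Ω) (s : ℝ) : ℝ :=
  if IsCovered c δ X C Y ω s then 1 else 0

/-- The uncovered time `V_T = ∫₀ᵀ (1 - ζ(s)) ds` of the target. -/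
def uncoveredTime {d : ℕ} [NeZero d] {Ω : Type*} (T c δ : ℝ) (X : ℕ → Ω → Space d)
    (C : ℕ → Ω → Closeds (Space d)) (Y : ℕ → ℝ≥0 → Ω → Fin 2) (ω : Ω) : ℝ :=
  ∫ s in (0 : ℝ)..T, (1 - coverIndicator c δ X C Y ω s)

/-- The mean volume `β = E ‖C‖` of a shape of law `Q`. -/
def meanVolume {d : ℕ} (Q : Measure (Closeds (Space d))) : ℝ :=
  ∫ F, volume.real (F : Set (Space d)) ∂Q

/-- The mean overlap `E ‖(x + C) ∩ C‖` of a shape of law `Q` with its translate by `x`. -/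
def meanOverlap {d : ℕ} (Q : Measure (Closeds (Space d))) (x : Space d) : ℝ :=
  ∫ F, volume.real ((x +ᵥ (F : Set (Space d))) ∩ (F : Set (Space d))) ∂Q

/-- The factor `e^{-a s}` for `a ∈ [0, ∞]` and `s > 0`, with `e^{-∞ s} = 0`. -/
def decay (a : ℝ≥0∞) (s : ℝ) : ℝ :=
  if a = ∞ then 0 else Real.exp (-(a.toReal * s))

/-- The limiting variance constant `σ₁²(a₀)`. -/
def limitVariance {d : ℕ} [NeZero d] (Q : Measure (Closeds (Space d))) (T c τ ρ p₁ : ℝ)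
    (a₀ : ℝ≥0∞) : ℝ :=
  2 * T * Real.exp (-(2 * p₁ * ρ * meanVolume Q)) *
    ∫ s in (0 : ℝ)..(2 * τ / c),
      (Real.exp (p₁ * ρ * meanOverlap Q (pathPoint d c s) * (p₁ + (1 - p₁) * decay a₀ s)) - 1)

end

/-! `uncoveredTime` is the length of the random set of uncovered times in `(0, T]`. By Fubini its
mean is the integral of one-point vacancy probabilities, and its variance the double integral over
the square of vacancy covariances.

Vacancy at times `s ≤ t` says that a marked Poisson process has no point in a certain set, so its
probability is `exp (-(lam * ∫ h))`, where `h x` is the chance that a sensor at `x` covers at least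
one of the two target positions (`measureReal_forall_notMem`). Inclusion-exclusion, independence of
shape and on/off process, and Fubini over `x` turn `∫ h` into `δ ^ d` times an expression in the
mean volume, the mean overlap at displacement `(t - s) / δ`, and the two-time on-probability `p * (p
+ (1 - p) * exp (-γ (t - s)))` of the chain (`measureReal_not_isCovered`).

Hence the covariance depends on `u = t - s` alone (`vacancyCov`) and vanishes once the target has
moved by more than the diameter `2 δ τ`. The substitution `u = δ v` pulls one factor `δ` out of the
variance (`moments_uncoveredTime`), and what remains converges by dominated convergence on the fixed
range `v ≤ 2 τ / c` (`tendsto_integral_vacancyCov`). The variance therefore tends to zero; since the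
uncovered time lies in `[0, T]`, so do all central absolute moments
(`integral_rpow_abs_sub_mean_le`). -/

/-! ### Generating functional and void probabilities of a marked Poisson process. -/

section PoissonProcess

theorem integral_pow_poissonMeasure (r : ℝ≥0) (z : ℝ) :
    ∫ k, z ^ k ∂(poissonMeasure r) = Real.exp (r * (z - 1)) := by
  have h : ∀ n : ℕ, (Real.exp (-r) * (r : ℝ) ^ n / n.factorial) • z ^ n =
      Real.exp (-r) * ((r * z) ^ n / n.factorial) := by
    intro n; rw [smul_eq_mul, mul_pow]; ring
  rw [integral_poissonMeasure]
  simp_rw [h]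
  rw [tsum_mul_left, ← (NormedSpace.expSeries_div_hasSum_exp ((r : ℝ) * z)).tsum_eq.symm,
    ← Real.exp_eq_exp_ℝ, ← Real.exp_add]
  congr 1; ring

variable {d : ℕ} {Ω : Type*} [MeasurableSpace Ω] {P : Measure Ω} {lam : ℝ} {X : ℕ → Ω → Space d}

/-- The prescribed law already forces this: `Measure.map` along a function that is not a.e.
measurable is zero by convention, whereas the Poisson law has mass one. -/
theorem IsStationaryPoisson.aemeasurable_pointCount (hX : IsStationaryPoisson P lam X)
    {B : Set (Space d)} (hB : MeasurableSet B) (hB' : volume B ≠ ∞) :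
    AEMeasurable (pointCount X B) P := by
  by_contra h
  have h1 := hX.map_count B hB hB'
  rw [Measure.map_of_not_aemeasurable h] at h1
  exact (IsProbabilityMeasure.ne_zero ((poissonMeasure (lam * volume.real B).toNNReal).map
    (fun k : ℕ => (k : ℕ∞)))) h1.symm

theorem IsStationaryPoisson.ae_pointCount_lt_top (hX : IsStationaryPoisson P lam X)
    {B : Set (Space d)} (hB : MeasurableSet B) (hB' : volume B ≠ ∞) :
    ∀ᵐ ω ∂P, pointCount X B ω ≠ ⊤ := by
  refine ae_of_ae_map (hX.aemeasurable_pointCount hB hB') (p := fun k : ℕ∞ => k ≠ ⊤) ?_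
  rw [hX.map_count B hB hB', ae_map_iff Measurable.of_discrete.aemeasurable
    (MeasurableSet.of_discrete)]
  simp

/-- The joint probability generating function of the numbers of points in disjoint sets. -/
theorem IsStationaryPoisson.integral_prod_pow (hX : IsStationaryPoisson P lam X) (hlam : 0 ≤ lam)
    {m : ℕ} {B : Fin m → Set (Space d)} (hB : ∀ k, MeasurableSet (B k))
    (hB' : ∀ k, volume (B k) ≠ ∞) (hd : Pairwise (fun k l => Disjoint (B k) (B l)))
    (z : Fin m → ℝ) :
    ∫ ω, ∏ k, z k ^ (pointCount X (B k) ω).toNat ∂P =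
      Real.exp (lam * ∑ k, volume.real (B k) * (z k - 1)) := by
  rw [(hX.indep_count m B hB hd).integral_fun_prod_comp (f := fun k (x : ℕ∞) => z k ^ x.toNat)
    (fun k => hX.aemeasurable_pointCount (hB k) (hB' k))
    (fun k => Measurable.of_discrete.aestronglyMeasurable), Finset.mul_sum, Real.exp_sum]
  refine Finset.prod_congr rfl fun k _ => ?_
  rw [← integral_map (φ := pointCount X (B k)) (f := fun x : ℕ∞ => z k ^ x.toNat)
    (hX.aemeasurable_pointCount (hB k) (hB' k)) Measurable.of_discrete.aestronglyMeasurable,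
    hX.map_count _ (hB k) (hB' k), integral_map Measurable.of_discrete.aemeasurable
    Measurable.of_discrete.aestronglyMeasurable]
  simp only [ENat.toNat_natCast]
  rw [integral_pow_poissonMeasure, Real.coe_toNNReal _ (mul_nonneg hlam measureReal_nonneg),
    mul_assoc]

/-- The generating functional of a Poisson process at a function of finitely many values. -/
theorem IsStationaryPoisson.integral_finprod_one_sub_floor (hX : IsStationaryPoisson P lam X)
    (hlam : 0 ≤ lam) {g : Space d → ℝ} (hg : Measurable g)
    (hg1 : ∀ x, g x ≤ 1) {A : Set (Space d)} (hA : MeasurableSet A) (hA' : volume A ≠ ∞)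
    (hgA : ∀ x ∉ A, g x = 0) (m : ℕ) :
    ∫ ω, ∏ᶠ n, (1 - (⌊g (X n ω) * m⌋₊ : ℝ) / m) ∂P =
      Real.exp (-(lam * ∫ x, (⌊g x * m⌋₊ : ℝ) / m)) := by
  -- The level sets of the discretised function. The value `k = m` occurs where `g = 1`, hence `m +
  -- 1` levels; intersecting with `A` keeps the level `0` of finite volume.
  set B : Fin (m + 1) → Set (Space d) := fun k => {x | ⌊g x * m⌋₊ = k} ∩ A with hBdef
  have hφ : Measurable fun x => ⌊g x * m⌋₊ := Nat.measurable_floor.comp (hg.mul_const _)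
  have hB : ∀ k, MeasurableSet (B k) := fun k => (hφ (measurableSet_singleton _)).inter hA
  have hB' : ∀ k, volume (B k) ≠ ∞ := fun k => measure_ne_top_of_subset Set.inter_subset_right hA'
  have hd : Pairwise (fun k l => Disjoint (B k) (B l)) := by
    intro k l hkl
    refine Set.disjoint_left.2 fun x hx hx' => hkl (Fin.ext ?_)
    exact hx.1.symm.trans hx'.1
  have hlt : ∀ x, ⌊g x * m⌋₊ < m + 1 := fun x => Nat.lt_succ_of_le <|
    Nat.floor_le_of_le (mul_le_of_le_one_left (Nat.cast_nonneg _) (hg1 x))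
  have key := hX.integral_prod_pow hlam hB hB' hd (fun k => 1 - (k : ℝ) / m)
  have hL : ∀ᵐ ω ∂P, ∏ᶠ n, (1 - (⌊g (X n ω) * m⌋₊ : ℝ) / m) =
      ∏ k, (fun k : Fin (m + 1) => 1 - (k : ℝ) / m) k ^ (pointCount X (B k) ω).toNat := by
    filter_upwards [hX.ae_pointCount_lt_top hA hA'] with ω hω
    have hfin : {n | X n ω ∈ A}.Finite := Set.encard_ne_top_iff.1 hω
    -- Points outside `A` contribute a factor `1`; the finitely many others are grouped by level, so
    -- that only the counts in the sets `B k` matter.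
    rw [finprod_eq_prod_of_mulSupport_subset (s := hfin.toFinset),
      ← Finset.prod_fiberwise_of_maps_to (t := (Finset.univ : Finset (Fin (m + 1))))
        (g := fun n => ⟨⌊g (X n ω) * m⌋₊, hlt _⟩) (fun _ _ => Finset.mem_univ _)]
    · refine Finset.prod_congr rfl fun k _ => ?_
      rw [Finset.prod_congr rfl (g := fun _ => 1 - (k : ℝ) / m), Finset.prod_const]
      · congr 1
        have : {n | X n ω ∈ B k} =
            ({i ∈ hfin.toFinset | (⟨⌊g (X i ω) * m⌋₊, hlt _⟩ : Fin (m + 1)) = k} : Finset ℕ) := by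
          ext n
          simp [hBdef, Fin.ext_iff, and_comm]
        rw [pointCount, this, Set.encard_coe_eq_coe_finsetCard, ENat.toNat_natCast]
      · intro n hn
        rw [← (Finset.mem_filter.1 hn).2]
    · intro n hn
      by_contra hnA
      have : X n ω ∉ A := by simpa using hnA
      simp [hgA _ this] at hn
  have hR : ∫ x, (⌊g x * m⌋₊ : ℝ) / m = ∑ k : Fin (m + 1), volume.real (B k) * ((k : ℝ) / m) := by
    have : (fun x => (⌊g x * m⌋₊ : ℝ) / m) =
        fun x => ∑ k : Fin (m + 1), (B k).indicator (fun _ => (k : ℝ) / m) x := by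
      funext x
      by_cases hx : x ∈ A
      · rw [Finset.sum_eq_single ⟨⌊g x * m⌋₊, hlt x⟩]
        · rw [Set.indicator_of_mem]
          exact ⟨rfl, hx⟩
        · intro k _ hk
          rw [Set.indicator_of_notMem]
          intro h
          exact hk (Fin.ext h.1.symm)
        · simp
      · rw [Finset.sum_eq_zero]
        · simp [hgA x hx]
        · intro k _
          rw [Set.indicator_of_notMem]
          exact fun h => hx h.2
    rw [this, integral_finsetSum]
    · refine Finset.sum_congr rfl fun k _ => ?_
      rw [integral_indicator (hB k), setIntegral_const, smul_eq_mul]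
    · exact fun k _ => (integrable_indicator_iff (hB k)).2 (integrableOn_const (hB' k))
  rw [integral_congr_ae hL, key, hR]
  congr 1
  rw [← mul_neg, ← Finset.sum_neg_distrib]
  congr 1
  exact Finset.sum_congr rfl fun k _ => by ring

/-- The discretisations `⌊g m⌋₊ / m` tend to `g`, and dominated convergence on both sides extends
the generating functional from them to `g`. Partial products are used so that the marks can later be
integrated out finitely many at a time. -/
theorem IsStationaryPoisson.tendsto_integral_prod (hX : IsStationaryPoisson P lam X)
    [IsProbabilityMeasure P]
    (hlam : 0 ≤ lam) {g : Space d → ℝ} (hg : Measurable g) (hg0 : ∀ x, 0 ≤ g x)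
    (hg1 : ∀ x, g x ≤ 1) {A : Set (Space d)} (hA : MeasurableSet A) (hA' : volume A ≠ ∞)
    (hgA : ∀ x ∉ A, g x = 0) :
    Tendsto (fun N => ∫ ω, ∏ n ∈ Finset.range N, (1 - g (X n ω)) ∂P) atTop
      (𝓝 (Real.exp (-(lam * ∫ x, g x)))) := by
  have h01 : ∀ (m : ℕ) x, 0 ≤ 1 - (⌊g x * m⌋₊ : ℝ) / m ∧ 1 - (⌊g x * m⌋₊ : ℝ) / m ≤ 1 := by
    intro m x
    have h1 : (⌊g x * m⌋₊ : ℝ) ≤ g x * m := Nat.floor_le (mul_nonneg (hg0 x) (Nat.cast_nonneg _))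
    have h2 : (⌊g x * m⌋₊ : ℝ) ≤ m :=
      h1.trans (mul_le_of_le_one_left (Nat.cast_nonneg _) (hg1 x))
    have h3 := div_le_one_of_le₀ h2 (Nat.cast_nonneg m)
    have h4 : 0 ≤ (⌊g x * m⌋₊ : ℝ) / m := by positivity
    constructor <;> linarith
  have hφ : ∀ m : ℕ, Measurable fun x => (⌊g x * m⌋₊ : ℝ) / m := fun m =>
    (measurable_from_nat.comp (Nat.measurable_floor.comp (hg.mul_const _))).div_const _
  have hlim : ∀ x, Tendsto (fun m : ℕ => (⌊g x * m⌋₊ : ℝ) / m) atTop (𝓝 (g x)) := fun x =>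
    (tendsto_nat_floor_mul_div_atTop (hg0 x)).comp tendsto_natCast_atTop_atTop
  -- Almost surely only finitely many factors differ from `1`, so `∏ᶠ` is a true product, not its
  -- default value, and the partial products are eventually constant.
  have hfin : ∀ᵐ ω ∂P, {n | X n ω ∈ A}.Finite := by
    filter_upwards [hX.ae_pointCount_lt_top hA hA'] with ω hω
    exact Set.encard_ne_top_iff.1 hω
  have hprod : ∀ f : Space d → ℝ, (∀ x ∉ A, f x = 1) → ∀ᵐ ω ∂P, ∀ s : Finset ℕ,
      {n | X n ω ∈ A} ⊆ s → ∏ᶠ n, f (X n ω) = ∏ n ∈ s, f (X n ω) := by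
    intro f hf
    filter_upwards with ω s hs
    refine finprod_eq_prod_of_mulSupport_subset _ fun n hn => hs ?_
    by_contra hnA
    exact hn (hf _ hnA)
  have hprodlim : ∀ f : Space d → ℝ, (∀ x ∉ A, f x = 1) → ∀ᵐ ω ∂P,
      Tendsto (fun N => ∏ n ∈ Finset.range N, f (X n ω)) atTop (𝓝 (∏ᶠ n, f (X n ω))) := by
    intro f hf
    filter_upwards [hfin, hprod f hf] with ω hω hω'
    obtain ⟨M, hM⟩ := hω.bddAbove
    refine tendsto_const_nhds.congr' ?_
    filter_upwards [eventually_gt_atTop M] with N hN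
    refine hω' _ fun n hn => ?_
    have := hM hn
    simp only [Finset.coe_range, Set.mem_Iio]
    omega
  have hprodmeas : ∀ f : Space d → ℝ, Measurable f → (∀ x ∉ A, f x = 1) →
      AEStronglyMeasurable (fun ω => ∏ᶠ n, f (X n ω)) P := by
    intro f hf hfA
    refine aestronglyMeasurable_of_tendsto_ae atTop (fun N => ?_) (hprodlim f hfA)
    exact (Finset.measurable_fun_prod _ fun n _ =>
      hf.comp (hX.measurable n)).aestronglyMeasurable
  have hstep : ∀ m : ℕ, ∀ x ∉ A, 1 - (⌊g x * m⌋₊ : ℝ) / m = 1 := by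
    intro m x hx
    simp [hgA x hx]
  have hlim1 : Tendsto (fun m : ℕ => ∫ ω, ∏ᶠ n, (1 - (⌊g (X n ω) * m⌋₊ : ℝ) / m) ∂P) atTop
      (𝓝 (∫ ω, ∏ᶠ n, (1 - g (X n ω)) ∂P)) := by
    refine tendsto_integral_of_dominated_convergence (fun _ => 1)
      (fun m => hprodmeas (fun x => 1 - (⌊g x * m⌋₊ : ℝ) / m) ((hφ m).const_sub 1) (hstep m))
      (integrable_const _) (fun m => ?_) ?_
    · filter_upwards [hfin, hprod (fun x => 1 - (⌊g x * m⌋₊ : ℝ) / m) (hstep m)] with ω hω hω'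
      rw [hω' hω.toFinset (by simp), Real.norm_eq_abs, abs_of_nonneg
        (Finset.prod_nonneg fun n _ => (h01 m _).1)]
      exact Finset.prod_le_one (fun n _ => (h01 m _).1) fun n _ => (h01 m _).2
    · have hall : ∀ᵐ ω ∂P, ∀ (m : ℕ) (s : Finset ℕ), {n | X n ω ∈ A} ⊆ s →
          ∏ᶠ n, (1 - (⌊g (X n ω) * m⌋₊ : ℝ) / m) = ∏ n ∈ s, (1 - (⌊g (X n ω) * m⌋₊ : ℝ) / m) :=
        ae_all_iff.2 fun m => hprod (fun x => 1 - (⌊g x * m⌋₊ : ℝ) / m) (hstep m)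
      filter_upwards [hfin, hall, hprod (fun x => 1 - g x) fun x hx => by simp [hgA x hx]]
        with ω hω h1 h2
      rw [h2 hω.toFinset (by simp)]
      simp_rw [fun m => h1 m hω.toFinset (by simp)]
      exact tendsto_finsetProd _ fun n _ => (hlim _).const_sub 1
  have hlim2 : Tendsto (fun m : ℕ => ∫ x, (⌊g x * m⌋₊ : ℝ) / m) atTop (𝓝 (∫ x, g x)) := by
    refine tendsto_integral_of_dominated_convergence (A.indicator fun _ => 1)
      (fun m => (hφ m).aestronglyMeasurable)
      ((integrable_indicator_iff hA).2 (integrableOn_const hA')) (fun m => ?_)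
      (ae_of_all _ fun x => hlim x)
    filter_upwards with x
    by_cases hx : x ∈ A
    · rw [Set.indicator_of_mem hx, Real.norm_eq_abs, abs_of_nonneg (by positivity)]
      linarith [(h01 m x).1]
    · simp [hgA x hx, hx]
  have hval : ∫ ω, ∏ᶠ n, (1 - g (X n ω)) ∂P = Real.exp (-(lam * ∫ x, g x)) := by
    refine tendsto_nhds_unique hlim1 ?_
    simp_rw [hX.integral_finprod_one_sub_floor hlam hg hg1 hA hA' hgA]
    exact (Real.continuous_exp.tendsto _).comp (hlim2.const_mul lam).neg
  rw [← hval]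
  refine tendsto_integral_of_dominated_convergence (fun _ => 1)
    (fun N => (Finset.measurable_fun_prod _ fun n _ =>
      (hg.comp (hX.measurable n)).const_sub 1).aestronglyMeasurable)
    (integrable_const _) (fun N => ?_) (hprodlim (fun x => 1 - g x) fun x hx => by simp [hgA x hx])
  filter_upwards with ω
  rw [Real.norm_eq_abs, abs_of_nonneg
    (Finset.prod_nonneg fun n _ => sub_nonneg.2 (hg1 _))]
  exact Finset.prod_le_one (fun n _ => sub_nonneg.2 (hg1 _)) fun n _ => by linarith [hg0 (X n ω)]

/-- The void probability of a Poisson process with independent i.i.d. marks: the probability that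
no marked point lies in `K`. -/
theorem IsStationaryPoisson.measureReal_forall_notMem (hX : IsStationaryPoisson P lam X)
    [IsProbabilityMeasure P] (hlam : 0 ≤ lam) {β : Type*} [MeasurableSpace β]
    {M : ℕ → Ω → β} (hM : ∀ n, Measurable (M n)) (hMi : iIndepFun M P)
    (hXM : IndepFun (fun ω n => X n ω) (fun ω n => M n ω) P)
    {K : Set (Space d × β)} (hK : MeasurableSet K) {h : Space d → ℝ}
    (hh : ∀ n x, P.real {ω | (x, M n ω) ∈ K} = h x)
    {A : Set (Space d)} (hA : MeasurableSet A) (hA' : volume A ≠ ∞) (hhA : ∀ x ∉ A, h x = 0) :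
    P.real {ω | ∀ n, (X n ω, M n ω) ∉ K} = Real.exp (-(lam * ∫ x, h x)) := by
  have hXm : Measurable fun ω n => X n ω := measurable_pi_iff.2 hX.measurable
  have hMm : Measurable fun ω n => M n ω := measurable_pi_iff.2 hM
  have hhm : Measurable h := by
    have : h = fun x => ((P.map (M 0)) (Prod.mk x ⁻¹' K)).toReal := by
      funext x
      rw [Measure.map_apply (hM 0) (measurable_prodMk_left hK), ← hh 0 x]
      rfl
    rw [this]
    have := Measure.isProbabilityMeasure_map (μ := P) (hM 0).aemeasurable
    exact (measurable_measure_prodMk_left hK).ennreal_toReal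
  have h0 : ∀ x, 0 ≤ h x := fun x => hh 0 x ▸ measureReal_nonneg
  have h1 : ∀ x, h x ≤ 1 := fun x => hh 0 x ▸ measureReal_le_one
  have hev : ∀ n, MeasurableSet {ω | (X n ω, M n ω) ∉ K} := fun n =>
    (((hX.measurable n).prodMk (hM n)) hK).compl
  -- Fubini for the product law of locations and marks: with the locations frozen, the independent
  -- marks avoid `K` with a product of probabilities.
  have hfin : ∀ N : ℕ, P.real {ω | ∀ n ∈ Finset.range N, (X n ω, M n ω) ∉ K} =
      ∫ ω, ∏ n ∈ Finset.range N, (1 - h (X n ω)) ∂P := by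
    intro N
    set D : Set ((ℕ → Space d) × (ℕ → β)) := {p | ∀ n ∈ Finset.range N, (p.1 n, p.2 n) ∉ K}
    have hD : MeasurableSet D := by
      have : D = ⋂ n ∈ Finset.range N,
          (fun p : (ℕ → Space d) × (ℕ → β) => (p.1 n, p.2 n)) ⁻¹' Kᶜ := by
        ext p; simp [D]
      rw [this]
      refine Finset.measurableSet_biInter _ fun n _ => ?_
      exact (((measurable_pi_apply n).comp measurable_fst).prodMk
        ((measurable_pi_apply n).comp measurable_snd)) hK.compl
    have hslice : ∀ x : ℕ → Space d, P {ω | (x, fun n => M n ω) ∈ D} =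
        ENNReal.ofReal (∏ n ∈ Finset.range N, (1 - h (x n))) := by
      intro x
      have e : {ω | (x, fun n => M n ω) ∈ D} =
          ⋂ n ∈ Finset.range N, M n ⁻¹' (Prod.mk (x n) ⁻¹' Kᶜ) := by
        ext ω; simp [D]
      rw [e, hMi.measure_inter_preimage_eq_mul _ fun n _ =>
        measurable_prodMk_left hK.compl, ENNReal.ofReal_prod_of_nonneg fun n _ => by
          linarith [h1 (x n)]]
      refine Finset.prod_congr rfl fun n _ => ?_
      rw [← ofReal_measureReal, Set.preimage_compl, Set.preimage_compl,
        probReal_compl_eq_one_sub ((hM n) (measurable_prodMk_left hK)), ← hh n (x n)]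
      rfl
    have e2 : P {ω | ∀ n ∈ Finset.range N, (X n ω, M n ω) ∉ K} =
        ∫⁻ ω, ENNReal.ofReal (∏ n ∈ Finset.range N, (1 - h (X n ω))) ∂P := by
      have : {ω | ∀ n ∈ Finset.range N, (X n ω, M n ω) ∉ K} =
          (fun ω => ((fun n => X n ω), (fun n => M n ω))) ⁻¹' D := rfl
      rw [this, ← Measure.map_apply (hXm.prodMk hMm) hD,
        (indepFun_iff_map_prod_eq_prod_map_map hXm.aemeasurable hMm.aemeasurable).1 hXM]
      have := Measure.isProbabilityMeasure_map (μ := P) hMm.aemeasurable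
      rw [Measure.prod_apply hD, lintegral_map (measurable_measure_prodMk_left hD) hXm]
      refine lintegral_congr fun ω => ?_
      rw [Measure.map_apply hMm (measurable_prodMk_left hD)]
      exact hslice _
    rw [measureReal_def, e2, integral_eq_lintegral_of_nonneg_ae]
    · exact ae_of_all _ fun ω => Finset.prod_nonneg fun n _ => sub_nonneg.2 (h1 _)
    · exact (Finset.measurable_fun_prod _ fun n _ =>
        (hhm.comp (hX.measurable n)).const_sub 1).aestronglyMeasurable
  have hlimit : Tendsto (fun N : ℕ => P.real {ω | ∀ n ∈ Finset.range N, (X n ω, M n ω) ∉ K}) atTop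
      (𝓝 (P.real {ω | ∀ n, (X n ω, M n ω) ∉ K})) := by
    have e : {ω | ∀ n, (X n ω, M n ω) ∉ K} =
        ⋂ N : ℕ, {ω | ∀ n ∈ Finset.range N, (X n ω, M n ω) ∉ K} := by
      ext ω
      simp only [Set.mem_ofPred_eq, Set.mem_iInter, Finset.mem_range]
      exact ⟨fun h _ n _ => h n, fun h n => h (n + 1) n n.lt_succ_self⟩
    rw [e]
    refine (ENNReal.tendsto_toReal (measure_ne_top P _)).comp
      (tendsto_measure_iInter_atTop (fun N => ?_) ?_ ⟨0, measure_ne_top P _⟩)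
    · have : {ω | ∀ n ∈ Finset.range N, (X n ω, M n ω) ∉ K} =
          ⋂ n ∈ Finset.range N, {ω | (X n ω, M n ω) ∉ K} := by
        ext ω; simp
      rw [this]
      exact (Finset.measurableSet_biInter _ fun n _ => hev n).nullMeasurableSet
    · intro N N' hN ω hω n hn
      exact hω n (Finset.range_mono hN hn)
  simp_rw [hfin] at hlimit
  exact tendsto_nhds_unique hlimit (hX.tendsto_integral_prod hlam hhm h0 h1 hA hA' hhA)

end PoissonProcess

/-! ### Measurability of random closed sets and Fubini over sensor positions. -/

section RandomClosedSet

variable {d : ℕ}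

/-- The membership relation between points and closed sets is jointly measurable. -/
theorem measurableSet_mem_closeds :
    MeasurableSet {p : Space d × Closeds (Space d) | p.1 ∈ p.2} := by
  -- Closedness of the set reduces membership to approximation at every scale `1 / (n + 1)` by
  -- centres in a countable dense set. Closed balls are compact here, so hitting one is an event of
  -- the Fell σ-algebra.
  have e : {p : Space d × Closeds (Space d) | p.1 ∈ p.2} = ⋂ n : ℕ, ⋃ k : ℕ,
      Metric.ball (TopologicalSpace.denseSeq (Space d) k) (1 / ((n : ℝ) + 1)) ×ˢ
        {F : Closeds (Space d) | ((F : Set (Space d)) ∩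
          Metric.closedBall (TopologicalSpace.denseSeq (Space d) k) (1 / ((n : ℝ) + 1))).Nonempty} := by
    ext ⟨x, F⟩
    simp only [Set.mem_ofPred_eq, Set.mem_iInter, Set.mem_iUnion, Set.mem_prod]
    constructor
    · intro hx n
      obtain ⟨k, hk⟩ := (TopologicalSpace.denseRange_denseSeq (Space d)).exists_dist_lt x
        (show (0 : ℝ) < 1 / ((n : ℝ) + 1) by positivity)
      exact ⟨k, hk, x, hx, hk.le⟩
    · intro h
      refine F.isClosed.closure_subset (Metric.mem_closure_iff.2 fun ε hε => ?_)
      obtain ⟨n, hn⟩ := exists_nat_one_div_lt (half_pos hε)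
      obtain ⟨k, hk, y, hyF, hy⟩ := h n
      refine ⟨y, hyF, ?_⟩
      have h1 := Metric.mem_ball.1 hk
      have h2 := Metric.mem_closedBall'.1 hy
      linarith [dist_triangle x (TopologicalSpace.denseSeq (Space d) k) y]
  rw [e]
  refine MeasurableSet.iInter fun n => MeasurableSet.iUnion fun k =>
    measurableSet_ball.prod (MeasurableSpace.measurableSet_generateFrom ⟨_, isCompact_closedBall _ _, rfl⟩)

theorem mem_vadd_smul_iff {δ : ℝ} (hδ : δ ≠ 0) (a x : Space d) (S : Set (Space d)) :
    a ∈ x +ᵥ δ • S ↔ δ⁻¹ • (a - x) ∈ S := by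
  rw [Set.mem_vadd_set_iff_neg_vadd_mem, Set.mem_smul_set_iff_inv_smul_mem₀ hδ, vadd_eq_add,
    neg_add_eq_sub]

theorem volume_preimage_smul_sub {δ : ℝ} (hδ : 0 < δ) (a : Space d) (S : Set (Space d)) :
    volume {x | δ⁻¹ • (a - x) ∈ S} = ENNReal.ofReal (δ ^ d) * volume S := by
  have h := (Measure.measurePreserving_sub_left (volume : Measure (Space d)) a).measure_preimage_emb
    (MeasurableEquiv.subLeft a).measurableEmbedding ((fun y : Space d => δ⁻¹ • y) ⁻¹' S)
  have h2 := Measure.addHaar_preimage_smul (volume : Measure (Space d)) (inv_ne_zero hδ.ne') S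
  rw [h2] at h
  rw [show {x | δ⁻¹ • (a - x) ∈ S} =
    (fun x => a - x) ⁻¹' ((fun y : Space d => δ⁻¹ • y) ⁻¹' S) from rfl, h]
  congr 2
  rw [finrank_euclideanSpace_fin, inv_pow, inv_inv, abs_of_pos (pow_pos hδ d)]

/-- Reduces two-point coverage by `S` to one-point coverage by the overlap of `S` with its
translate, so the volume formula for one point applies to pairs. -/
theorem preimage_inter_preimage_smul_sub {δ : ℝ} (a b : Space d) (S : Set (Space d)) :
    {x | δ⁻¹ • (a - x) ∈ S ∧ δ⁻¹ • (b - x) ∈ S} =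
      {x | δ⁻¹ • (b - x) ∈ (δ⁻¹ • (b - a) +ᵥ S) ∩ S} := by
  ext x
  simp only [Set.mem_ofPred_eq, Set.mem_inter_iff, Set.mem_vadd_set_iff_neg_vadd_mem, vadd_eq_add]
  rw [show -(δ⁻¹ • (b - a)) + δ⁻¹ • (b - x) = δ⁻¹ • (a - x) by
    rw [← smul_neg, ← smul_add]; congr 1; abel]

variable (Q : Measure (Closeds (Space d))) [IsProbabilityMeasure Q]

/-- Tonelli for `volume` and `Q`. The uniform bound `v` excludes infinite values, for which the
real-valued integrals would be defaults. -/
theorem integral_measureReal_slice {D : Set (Space d × Closeds (Space d))} (hD : MeasurableSet D)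
    {v : ℝ≥0∞} (hv : v ≠ ∞) (h : ∀ᵐ F ∂Q, volume {x | (x, F) ∈ D} ≤ v) :
    Integrable (fun x => Q.real {F | (x, F) ∈ D}) ∧
      ∫ x, Q.real {F | (x, F) ∈ D} = ∫ F, volume.real {x | (x, F) ∈ D} ∂Q := by
  have e : ∫⁻ x, Q {F | (x, F) ∈ D} = ∫⁻ F, volume {x | (x, F) ∈ D} ∂Q :=
    (Measure.prod_apply (μ := volume) (ν := Q) hD).symm.trans (Measure.prod_apply_symm hD)
  have hlt : ∫⁻ x, Q {F | (x, F) ∈ D} ≠ ∞ := by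
    rw [e]
    refine ((lintegral_mono_ae h).trans_lt ?_).ne
    rw [lintegral_const, measure_univ, mul_one]
    exact hv.lt_top
  have m1 : Measurable fun x => Q {F | (x, F) ∈ D} := measurable_measure_prodMk_left hD
  have m2 : Measurable fun F => (volume : Measure (Space d)) {x | (x, F) ∈ D} :=
    measurable_measure_prodMk_right hD
  refine ⟨integrable_toReal_of_lintegral_ne_top m1.aemeasurable hlt, ?_⟩
  simp only [measureReal_def]
  rw [integral_toReal m1.aemeasurable (ae_of_all _ fun x => measure_lt_top _ _), e,
    integral_toReal m2.aemeasurable]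
  filter_upwards [h] with F hF using hF.trans_lt hv.lt_top

end RandomClosedSet

/-! ### One- and two-time on-probabilities of the on/off chain. -/

section OnOff

theorem diagonal_fin_two {R : Type*} [Zero R] (a b : R) :
    Matrix.diagonal ![a, b] = !![a, 0; 0, b] := by
  ext i j
  fin_cases i <;> fin_cases j <;> simp

/-- The generator has eigenvalues `0` and `-(μ₀ + μ₁)`; the columns of `U` are eigenvectors, and the
exponential is taken in that basis. -/
theorem transition_apply_one {μ₀ μ₁ : ℝ} (hγ : 0 < μ₀ + μ₁) (t : ℝ) :
    transition μ₀ μ₁ t 0 1 = μ₀ / (μ₁ + μ₀) * (1 - Real.exp (-((μ₀ + μ₁) * t))) ∧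
    transition μ₀ μ₁ t 1 1 = μ₀ / (μ₁ + μ₀) +
      (1 - μ₀ / (μ₁ + μ₀)) * Real.exp (-((μ₀ + μ₁) * t)) := by
  set U : Matrix (Fin 2) (Fin 2) ℝ := !![1, -μ₀; 1, μ₁] with hU
  have hdet : U.det = μ₀ + μ₁ := by simp [hU, Matrix.det_fin_two]; ring
  have hUu : IsUnit U := by
    rw [Matrix.isUnit_iff_isUnit_det, hdet]; exact hγ.ne'.isUnit
  have hinv : U⁻¹ = (μ₀ + μ₁)⁻¹ • !![μ₁, μ₀; -1, 1] := by
    rw [Matrix.inv_def, hdet, Ring.inverse_eq_inv', hU, Matrix.adjugate_fin_two_of]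
    simp
  have hne := hγ.ne'
  have hne' : μ₁ + μ₀ ≠ 0 := by linarith
  have hconj : t • generator μ₀ μ₁ =
      U * Matrix.diagonal ![0, -((μ₀ + μ₁) * t)] * U⁻¹ := by
    rw [hinv, hU, generator, diagonal_fin_two]
    ext i j
    fin_cases i <;> fin_cases j <;>
      simp [Matrix.mul_apply, Fin.sum_univ_two] <;> field_simp
  have hexp : transition μ₀ μ₁ t =
      U * Matrix.diagonal ![1, Real.exp (-((μ₀ + μ₁) * t))] * U⁻¹ := by
    rw [transition, hconj, Matrix.exp_conj _ _ hUu, Matrix.exp_diagonal]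
    congr 3
    funext i
    rw [Pi.coe_exp, ← Real.exp_eq_exp_ℝ]
    fin_cases i <;> simp
  rw [hexp, hinv, hU, diagonal_fin_two]
  constructor <;>
    simp [Matrix.mul_apply, Fin.sum_univ_two] <;> field_simp <;> ring

variable {Ω : Type*} [MeasurableSpace Ω] {P : Measure Ω}
  {μ₀ μ₁ : ℝ} {Y : ℝ≥0 → Ω → Fin 2}

theorem IsStationaryOnOff.measureReal_inter (hY : IsStationaryOnOff P μ₀ μ₁ Y) {s t : ℝ≥0}
    (hst : s ≤ t) (j k : Fin 2) :
    P.real {ω | Y s ω = j ∧ Y t ω = k} =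
      P.real {ω | Y s ω = j} * transition μ₀ μ₁ ((t : ℝ) - (s : ℝ)) j k := by
  simpa using hY.markov 0 Fin.elim0 Fin.elim0 s t (fun i => i.elim0) hst j k

variable [IsProbabilityMeasure P]

/-- The on-probability is the same at times `0` and `1`. Splitting on the state at time `0` gives a
linear equation whose solution is unique because `exp (-(μ₀ + μ₁)) < 1`. -/
theorem IsStationaryOnOff.measureReal_on (hY : IsStationaryOnOff P μ₀ μ₁ Y)
    (hγ : 0 < μ₀ + μ₁) (t : ℝ≥0) : P.real {ω | Y t ω = 1} = μ₀ / (μ₁ + μ₀) := by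
  have hsplit : P.real {ω | Y 0 ω = 0 ∧ Y 1 ω = 1} + P.real {ω | Y 0 ω = 1 ∧ Y 1 ω = 1} =
      P.real {ω | Y 1 ω = 1} := by
    rw [← measureReal_union]
    · congr 1
      ext ω
      simp only [Set.mem_union, Set.mem_ofPred_eq, ← or_and_right]
      exact ⟨fun h => h.2, fun h => ⟨by rcases Fin.exists_fin_two.1 ⟨Y 0 ω, rfl⟩ with h | h <;> simp [h], h⟩⟩
    · refine Set.disjoint_left.2 fun ω h1 h2 => ?_
      have := h1.1.symm.trans h2.1
      simp at this
    · exact (hY.measurable 0 (measurableSet_singleton 1)).inter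
        (hY.measurable 1 (measurableSet_singleton 1))
  have hcompl : P.real {ω | Y 0 ω = 0} = 1 - P.real {ω | Y 0 ω = 1} := by
    rw [← probReal_compl_eq_one_sub (s := {ω | Y 0 ω = 1})
      (hY.measurable 0 (measurableSet_singleton 1))]
    congr 1
    ext ω
    simp only [Set.mem_ofPred_eq, Set.mem_compl_iff]
    omega
  rw [hY.measureReal_inter zero_le_one, hY.measureReal_inter zero_le_one, hY.stationary 1 1,
    hcompl, (transition_apply_one hγ _).1, (transition_apply_one hγ _).2] at hsplit
  rw [hY.stationary]
  have hE : Real.exp (-((μ₀ + μ₁) * ((1 : ℝ≥0) - (0 : ℝ≥0) : ℝ))) < 1 := by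
    rw [Real.exp_lt_one_iff]; simp only [NNReal.coe_one, NNReal.coe_zero]; linarith
  set E := Real.exp (-((μ₀ + μ₁) * ((1 : ℝ≥0) - (0 : ℝ≥0) : ℝ)))
  have : (P.real {ω | Y 0 ω = 1} - μ₀ / (μ₁ + μ₀)) * (1 - E) = 0 := by linear_combination -hsplit
  rcases mul_eq_zero.1 this with h | h <;> linarith

theorem IsStationaryOnOff.measureReal_on_on (hY : IsStationaryOnOff P μ₀ μ₁ Y)
    (hγ : 0 < μ₀ + μ₁) {s t : ℝ≥0} (hst : s ≤ t) :
    P.real {ω | Y s ω = 1 ∧ Y t ω = 1} = μ₀ / (μ₁ + μ₀) * (μ₀ / (μ₁ + μ₀) +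
      (1 - μ₀ / (μ₁ + μ₀)) * Real.exp (-((μ₀ + μ₁) * ((t : ℝ) - s)))) := by
  rw [hY.measureReal_inter hst, hY.measureReal_on hγ, (transition_apply_one hγ _).2]

end OnOff

/-! ### Coverage probabilities integrated over the sensor position. -/

section VoidProbability

variable {d : ℕ} (Q : Measure (Closeds (Space d)))

theorem measurableSet_smul_sub_mem (δ : ℝ) (a : Space d) :
    MeasurableSet {p : Space d × Closeds (Space d) | δ⁻¹ • (a - p.1) ∈ p.2} :=
  (((measurable_fst.const_sub a).const_smul δ⁻¹).prodMk measurable_snd) measurableSet_mem_closeds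

/-- Only sensors within `δ * τ` of the target can cover it; this supplies the set of finite volume
needed for the void probability. -/
theorem measureReal_smul_sub_mem_eq_zero {τ : ℝ}
    (hQ : ∀ᵐ F : Closeds (Space d) ∂Q, (F : Set (Space d)) ⊆ Metric.closedBall 0 τ)
    {δ : ℝ} (hδ : 0 < δ) (a : Space d) {x : Space d} (hx : x ∉ Metric.closedBall a (δ * τ)) :
    Q.real {F | δ⁻¹ • (a - x) ∈ F} = 0 := by
  rw [measureReal_def, measure_eq_zero_iff_ae_notMem.2, ENNReal.toReal_zero]
  filter_upwards [hQ] with F hF h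
  refine hx ?_
  have h1 := mem_closedBall_zero_iff.1 (hF h)
  rw [norm_smul, Real.norm_eq_abs, abs_of_pos (inv_pos.2 hδ), inv_mul_le_iff₀ hδ] at h1
  rwa [Metric.mem_closedBall', dist_eq_norm]

theorem meanOverlap_zero : meanOverlap Q 0 = meanVolume Q := by
  simp [meanOverlap, meanVolume]

variable [IsProbabilityMeasure Q]

theorem integral_measureReal_smul_sub_mem {τ : ℝ}
    (hQ : ∀ᵐ F : Closeds (Space d) ∂Q, (F : Set (Space d)) ⊆ Metric.closedBall 0 τ)
    {δ : ℝ} (hδ : 0 < δ) (a : Space d) :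
    Integrable (fun x => Q.real {F | δ⁻¹ • (a - x) ∈ F}) ∧
      ∫ x, Q.real {F | δ⁻¹ • (a - x) ∈ F} = δ ^ d * meanVolume Q := by
  have h := integral_measureReal_slice Q (measurableSet_smul_sub_mem δ a)
    (v := ENNReal.ofReal (δ ^ d) * volume (Metric.closedBall (0 : Space d) τ))
    (ENNReal.mul_ne_top ENNReal.ofReal_ne_top measure_closedBall_lt_top.ne) (by
      filter_upwards [hQ] with F hF
      exact (volume_preimage_smul_sub hδ a F).trans_le (by gcongr))
  refine ⟨h.1, h.2.trans ?_⟩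
  rw [meanVolume, ← integral_const_mul]
  refine integral_congr_ae (ae_of_all _ fun F => ?_)
  have := volume_preimage_smul_sub hδ a (F : Set (Space d))
  simp only [measureReal_def]
  refine (congrArg ENNReal.toReal this).trans ?_
  rw [ENNReal.toReal_mul, ENNReal.toReal_ofReal (by positivity)]

theorem integral_measureReal_smul_sub_mem_and {τ : ℝ}
    (hQ : ∀ᵐ F : Closeds (Space d) ∂Q, (F : Set (Space d)) ⊆ Metric.closedBall 0 τ)
    {δ : ℝ} (hδ : 0 < δ) (a b : Space d) :
    Integrable (fun x => Q.real {F | δ⁻¹ • (a - x) ∈ F ∧ δ⁻¹ • (b - x) ∈ F}) ∧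
      ∫ x, Q.real {F | δ⁻¹ • (a - x) ∈ F ∧ δ⁻¹ • (b - x) ∈ F} =
        δ ^ d * meanOverlap Q (δ⁻¹ • (b - a)) := by
  have e : ∀ F : Closeds (Space d), volume {x | δ⁻¹ • (a - x) ∈ F ∧ δ⁻¹ • (b - x) ∈ F} =
      ENNReal.ofReal (δ ^ d) * volume ((δ⁻¹ • (b - a) +ᵥ (F : Set (Space d))) ∩ F) := by
    intro F
    have := preimage_inter_preimage_smul_sub (δ := δ) a b (F : Set (Space d))
    exact (congrArg volume this).trans (volume_preimage_smul_sub hδ b _)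
  have h := integral_measureReal_slice Q
    ((measurableSet_smul_sub_mem δ a).inter (measurableSet_smul_sub_mem δ b))
    (v := ENNReal.ofReal (δ ^ d) * volume (Metric.closedBall (0 : Space d) τ))
    (ENNReal.mul_ne_top ENNReal.ofReal_ne_top measure_closedBall_lt_top.ne) (by
      filter_upwards [hQ] with F hF
      refine (e F).trans_le ?_
      gcongr
      exact Set.inter_subset_right.trans hF)
  refine ⟨h.1, h.2.trans ?_⟩
  rw [meanOverlap, ← integral_const_mul]
  refine integral_congr_ae (ae_of_all _ fun F => ?_)
  simp only [measureReal_def]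
  refine (congrArg ENNReal.toReal (e F)).trans ?_
  rw [ENNReal.toReal_mul, ENNReal.toReal_ofReal (by positivity)]

end VoidProbability

/-! ### Joint vacancy probability at two times. -/

section Model

variable {d : ℕ} [NeZero d] {Ω : Type*}
  {X : ℕ → Ω → Space d} {C : ℕ → Ω → Closeds (Space d)} {Y : ℕ → ℝ≥0 → Ω → Fin 2}

theorem pathPoint_sub (c s t : ℝ) : pathPoint d c t - pathPoint d c s = pathPoint d c (t - s) := by
  ext i
  by_cases h : i = 0 <;> simp [pathPoint, h]
  ring

theorem smul_pathPoint (r c s : ℝ) : r • pathPoint d c s = pathPoint d c (r * s) := by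
  ext i
  by_cases h : i = 0 <;> simp [pathPoint, h]
  ring

theorem norm_pathPoint (c s : ℝ) : ‖pathPoint d c s‖ = |c * s| := by
  simp [pathPoint]

theorem isCovered_iff {c δ : ℝ} (hδ : δ ≠ 0) (ω : Ω) (s : ℝ) :
    IsCovered c δ X C Y ω s ↔
      ∃ n, Y n s.toNNReal ω = 1 ∧ δ⁻¹ • (pathPoint d c s - X n ω) ∈ C n ω := by
  simp only [IsCovered, mem_vadd_smul_iff hδ, SetLike.mem_coe]

variable [MeasurableSpace Ω] {P : Measure Ω} {lam μ₀ μ₁ : ℝ} {Q : Measure (Closeds (Space d))}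

/-- The probability that neither of two points of the path is covered. -/
theorem IsMarkovPoissonBoolean.measureReal_not_isCovered
    [IsProbabilityMeasure P] [IsProbabilityMeasure Q]
    (hm : IsMarkovPoissonBoolean P lam Q μ₀ μ₁ X C Y) (hlam : 0 ≤ lam) (hγ : 0 < μ₀ + μ₁)
    {τ : ℝ} (hQ : ∀ᵐ F : Closeds (Space d) ∂Q, (F : Set (Space d)) ⊆ Metric.closedBall 0 τ)
    {δ : ℝ} (hδ : 0 < δ) (c : ℝ) {s t : ℝ} (hs : 0 ≤ s) (hst : s ≤ t) :
    P.real {ω | ¬ IsCovered c δ X C Y ω s ∧ ¬ IsCovered c δ X C Y ω t} =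
      Real.exp (-(lam * (2 * (μ₀ / (μ₁ + μ₀)) * (δ ^ d * meanVolume Q) -
        μ₀ / (μ₁ + μ₀) * (μ₀ / (μ₁ + μ₀) +
          (1 - μ₀ / (μ₁ + μ₀)) * Real.exp (-((μ₀ + μ₁) * (t - s)))) *
        (δ ^ d * meanOverlap Q (pathPoint d c (δ⁻¹ * (t - s))))))) := by
  set a := pathPoint d c s
  set b := pathPoint d c t
  set p := μ₀ / (μ₁ + μ₀)
  set r := p * (p + (1 - p) * Real.exp (-((μ₀ + μ₁) * (t - s)))) with hr
  -- The marked points that cover the target at time `s` or at time `t`: joint vacancy is the void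
  -- event of `K`.
  set K : Set (Space d × (Closeds (Space d) × (ℝ≥0 → Fin 2))) :=
    {q | (q.2.2 s.toNNReal = 1 ∧ δ⁻¹ • (a - q.1) ∈ q.2.1) ∨
      (q.2.2 t.toNNReal = 1 ∧ δ⁻¹ • (b - q.1) ∈ q.2.1)} with hKdef
  have hKm : MeasurableSet K := by
    have h1 : ∀ (u : ℝ≥0) (x : Space d),
        MeasurableSet {q : Space d × (Closeds (Space d) × (ℝ≥0 → Fin 2)) |
          q.2.2 u = 1 ∧ δ⁻¹ • (x - q.1) ∈ q.2.1} := by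
      intro u x
      refine MeasurableSet.inter ?_ ?_
      · exact ((measurable_pi_apply u).comp (measurable_snd.comp measurable_snd))
          (measurableSet_singleton 1)
      · exact (measurable_fst.prodMk (measurable_fst.comp measurable_snd))
          (measurableSet_smul_sub_mem δ x)
    exact (h1 _ _).union (h1 _ _)
  have hevent : {ω | ¬ IsCovered c δ X C Y ω s ∧ ¬ IsCovered c δ X C Y ω t} =
      {ω | ∀ n, (X n ω, (C n ω, fun u => Y n u ω)) ∉ K} := by
    ext ω
    simp only [Set.mem_ofPred_eq, isCovered_iff hδ.ne', hKdef, not_exists, ← forall_and, not_or]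
    rfl
  have hM : ∀ n, Measurable fun ω => (C n ω, fun u => Y n u ω) := fun n =>
    (hm.shape_measurable n).prodMk (measurable_pi_iff.2 fun u => (hm.onOff n).measurable u)
  have hprod : ∀ n (S : Set (Closeds (Space d))) (B : Set (ℝ≥0 → Fin 2)), MeasurableSet S →
      MeasurableSet B → P.real {ω | (fun u => Y n u ω) ∈ B ∧ C n ω ∈ S} =
        P.real {ω | (fun u => Y n u ω) ∈ B} * Q.real S := by
    intro n S B hS hB
    have h1 := (hm.indep_shape_onOff n).measure_inter_preimage_eq_mul S B hS hB
    have h2 : P.real (C n ⁻¹' S) = Q.real S := by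
      rw [← hm.shape_law n, map_measureReal_apply (hm.shape_measurable n) hS]
    have h3 : {ω | (fun u => Y n u ω) ∈ B ∧ C n ω ∈ S} =
        C n ⁻¹' S ∩ (fun ω u => Y n u ω) ⁻¹' B := by
      ext ω; exact and_comm
    rw [h3, measureReal_def, h1, ENNReal.toReal_mul, ← measureReal_def, h2, mul_comm]
    rfl
  have hSm : ∀ y x : Space d, MeasurableSet {F : Closeds (Space d) | δ⁻¹ • (y - x) ∈ F} :=
    fun y x => measurable_prodMk_left (measurableSet_smul_sub_mem δ y)
  have hBm : ∀ u : ℝ≥0, MeasurableSet {y : ℝ≥0 → Fin 2 | y u = 1} := fun u =>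
    measurable_pi_apply u (measurableSet_singleton 1)
  -- Inclusion-exclusion for the two coverage events, each factored by the independence of shape and
  -- on/off process; `r` is the probability of being on at both times.
  have hh : ∀ n x, P.real {ω | (x, (C n ω, fun u => Y n u ω)) ∈ K} =
      p * Q.real {F | δ⁻¹ • (a - x) ∈ F} + p * Q.real {F | δ⁻¹ • (b - x) ∈ F} -
        r * Q.real {F | δ⁻¹ • (a - x) ∈ F ∧ δ⁻¹ • (b - x) ∈ F} := by
    intro n x
    have u1 := hprod n _ _ (hSm a x) (hBm s.toNNReal)
    have u2 := hprod n _ _ (hSm b x) (hBm t.toNNReal)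
    have u3 := hprod n _ _ ((hSm a x).inter (hSm b x)) ((hBm s.toNNReal).inter (hBm t.toNNReal))
    have v1 := (hm.onOff n).measureReal_on hγ s.toNNReal
    have v2 := (hm.onOff n).measureReal_on hγ t.toNNReal
    have v3 := (hm.onOff n).measureReal_on_on hγ (Real.toNNReal_le_toNNReal hst)
    rw [Real.coe_toNNReal _ hs, Real.coe_toNNReal _ (hs.trans hst)] at v3
    have hmeas : MeasurableSet {ω | (fun u => Y n u ω) ∈ {y : ℝ≥0 → Fin 2 | y t.toNNReal = 1} ∧
        C n ω ∈ {F : Closeds (Space d) | δ⁻¹ • (b - x) ∈ F}} :=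
      ((hm.onOff n).measurable _ (measurableSet_singleton 1)).inter
        (hm.shape_measurable n (hSm b x))
    have w := measureReal_union_add_inter (μ := P)
      (s := {ω | (fun u => Y n u ω) ∈ {y : ℝ≥0 → Fin 2 | y s.toNNReal = 1} ∧
        C n ω ∈ {F : Closeds (Space d) | δ⁻¹ • (a - x) ∈ F}}) hmeas
    have w1 : ({ω | (fun u => Y n u ω) ∈ {y : ℝ≥0 → Fin 2 | y s.toNNReal = 1} ∧
        C n ω ∈ {F : Closeds (Space d) | δ⁻¹ • (a - x) ∈ F}} ∩
        {ω | (fun u => Y n u ω) ∈ {y : ℝ≥0 → Fin 2 | y t.toNNReal = 1} ∧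
        C n ω ∈ {F : Closeds (Space d) | δ⁻¹ • (b - x) ∈ F}}) =
        {ω | (fun u => Y n u ω) ∈ {y : ℝ≥0 → Fin 2 | y s.toNNReal = 1} ∩
          {y : ℝ≥0 → Fin 2 | y t.toNNReal = 1} ∧
        C n ω ∈ {F : Closeds (Space d) | δ⁻¹ • (a - x) ∈ F} ∩
          {F : Closeds (Space d) | δ⁻¹ • (b - x) ∈ F}} := by
      ext ω; exact and_and_and_comm
    rw [w1, u1, u2, u3] at w
    have v1' : P.real {ω | (fun u => Y n u ω) ∈ {y : ℝ≥0 → Fin 2 | y s.toNNReal = 1}} = p := v1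
    have v2' : P.real {ω | (fun u => Y n u ω) ∈ {y : ℝ≥0 → Fin 2 | y t.toNNReal = 1}} = p := v2
    have v3' : P.real {ω | (fun u => Y n u ω) ∈ {y : ℝ≥0 → Fin 2 | y s.toNNReal = 1} ∩
      {y : ℝ≥0 → Fin 2 | y t.toNNReal = 1}} = r := v3
    rw [v1', v2', v3'] at w
    exact eq_sub_of_add_eq w
  have hvoid := hm.poisson.measureReal_forall_notMem hlam hM hm.indep_marks hm.indep_points hKm hh
    (A := Metric.closedBall a (δ * τ) ∪ Metric.closedBall b (δ * τ))
    (Metric.isClosed_closedBall.measurableSet.union Metric.isClosed_closedBall.measurableSet)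
    (measure_union_lt_top measure_closedBall_lt_top measure_closedBall_lt_top).ne (by
      intro x hx
      rw [Set.mem_union, not_or] at hx
      have z1 := measureReal_smul_sub_mem_eq_zero Q hQ hδ a hx.1
      have z2 := measureReal_smul_sub_mem_eq_zero Q hQ hδ b hx.2
      have z3 : Q.real {F | δ⁻¹ • (a - x) ∈ F ∧ δ⁻¹ • (b - x) ∈ F} = 0 :=
        le_antisymm (z1 ▸ measureReal_mono fun F hF => hF.1) measureReal_nonneg
      rw [z1, z2, z3]; ring)
  obtain ⟨i1, j1⟩ := integral_measureReal_smul_sub_mem Q hQ hδ a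
  obtain ⟨i2, j2⟩ := integral_measureReal_smul_sub_mem Q hQ hδ b
  obtain ⟨i3, j3⟩ := integral_measureReal_smul_sub_mem_and Q hQ hδ a b
  have i12 : Integrable fun x => p * Q.real {F | δ⁻¹ • (a - x) ∈ F} +
      p * Q.real {F | δ⁻¹ • (b - x) ∈ F} := (i1.const_mul p).add (i2.const_mul p)
  rw [hevent, hvoid, integral_sub i12 (i3.const_mul r),
    integral_add (i1.const_mul p) (i2.const_mul p), integral_const_mul, integral_const_mul,
    integral_const_mul, j1, j2, j3, pathPoint_sub, smul_pathPoint]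
  congr 3
  ring

end Model

/-! ### Joint measurability of coverage in time and chance. -/

section JointMeasurability

/-- A right-continuous on/off process has, up to a null set, a jointly measurable on-set. -/
theorem IsStationaryOnOff.exists_measurableSet {Ω : Type*} [MeasurableSpace Ω] {P : Measure Ω}
    {μ₀ μ₁ : ℝ} {Y : ℝ≥0 → Ω → Fin 2} (hY : IsStationaryOnOff P μ₀ μ₁ Y) :
    ∃ G : Set (ℝ≥0 × Ω), MeasurableSet G ∧ ∀ᵐ ω ∂P, ∀ t, (t, ω) ∈ G ↔ Y t ω = 1 := by
  -- `u m ⌊t (m + 1)⌋₊` is the first point strictly after `t` of the grid of mesh `1 / (m + 1)`.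
  -- Strictness matters, since right-continuity is stated along `𝓝[>] t`.
  set u : ℕ → ℕ → ℝ≥0 := fun m k => ((k : ℝ≥0) + 1) / (m + 1) with hu
  have hA : ∀ m : ℕ, MeasurableSet {q : ℝ≥0 × Ω | Y (u m ⌊q.1 * (m + 1)⌋₊) q.2 = 1} := by
    intro m
    have h1 : Measurable fun q : ℕ × Ω => Y (u m q.1) q.2 :=
      measurable_from_prod_countable_right fun k => hY.measurable (u m k)
    have h2 : Measurable fun q : ℝ≥0 × Ω => (⌊q.1 * (m + 1)⌋₊, q.2) :=
      (Nat.measurable_floor.comp (measurable_fst.mul_const _)).prodMk measurable_snd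
    exact (h1.comp h2) (measurableSet_singleton 1)
  -- The set-theoretic lower limit of the on-sets read off the grids; right-continuity makes the
  -- grid values eventually equal to `Y t ω`.
  refine ⟨⋃ N : ℕ, ⋂ m : ℕ, ⋂ _ : N ≤ m, {q | Y (u m ⌊q.1 * (m + 1)⌋₊) q.2 = 1},
    MeasurableSet.iUnion fun N => MeasurableSet.iInter fun m => MeasurableSet.iInter fun _ => hA m,
    ?_⟩
  filter_upwards [hY.right_cont] with ω hω t
  have hlim : Tendsto (fun m : ℕ => u m ⌊t * (m + 1)⌋₊) atTop (𝓝[>] t) := by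
    have hpos : ∀ m : ℕ, (0 : ℝ≥0) < m + 1 := fun m => by positivity
    refine tendsto_nhdsWithin_iff.2 ⟨?_, Eventually.of_forall fun m => ?_⟩
    · refine tendsto_of_tendsto_of_tendsto_of_le_of_le (g := fun _ => t)
        (h := fun m : ℕ => t + 1 / ((m : ℝ≥0) + 1)) tendsto_const_nhds ?_ (fun m => ?_) fun m => ?_
      · simpa using (tendsto_one_div_add_atTop_nhds_zero_nat (𝕜 := ℝ≥0)).const_add t
      · exact (le_div_iff₀ (hpos m)).2 (Nat.lt_floor_add_one _).le
      · simp only [hu]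
        rw [div_le_iff₀ (hpos m), add_mul, one_div, inv_mul_cancel₀ (hpos m).ne']
        gcongr
        exact Nat.floor_le (by positivity)
    · exact (lt_div_iff₀ (hpos m)).2 (Nat.lt_floor_add_one _)
  have hev := hlim.eventually (hω t)
  obtain ⟨N, hN⟩ := eventually_atTop.1 hev
  simp only [Set.mem_iUnion, Set.mem_iInter, Set.mem_ofPred_eq]
  constructor
  · rintro ⟨M, hM⟩
    rw [← hN (max N M) (le_max_left _ _)]
    exact hM _ (le_max_right _ _)
  · intro h
    exact ⟨N, fun m hm => (hN m hm).trans h⟩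

theorem measurable_pathPoint (d : ℕ) [NeZero d] (c : ℝ) : Measurable (pathPoint d c) := by
  have : pathPoint d c = fun s => s • EuclideanSpace.single 0 c := by
    funext s
    ext i
    by_cases h : i = 0 <;> simp [pathPoint, h, mul_comm]
  rw [this]
  exact measurable_id.smul_const _

/-- One null set serves all times `s` at once, as it comes from the paths of the countably many
sensors; almost every path of `ζ` is thereby measurable. -/
theorem IsMarkovPoissonBoolean.exists_measurableSet_isCovered
    {d : ℕ} [NeZero d] {Ω : Type*} [MeasurableSpace Ω] {P : Measure Ω}
    {lam μ₀ μ₁ : ℝ} {Q : Measure (Closeds (Space d))}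
    {X : ℕ → Ω → Space d} {C : ℕ → Ω → Closeds (Space d)} {Y : ℕ → ℝ≥0 → Ω → Fin 2}
    (hm : IsMarkovPoissonBoolean P lam Q μ₀ μ₁ X C Y) (c : ℝ) {δ : ℝ} (hδ : δ ≠ 0) :
    ∃ G : Set (ℝ × Ω), MeasurableSet G ∧
      ∀ᵐ ω ∂P, ∀ s, (s, ω) ∈ G ↔ ¬ IsCovered c δ X C Y ω s := by
  choose G hG hGY using fun n => (hm.onOff n).exists_measurableSet
  refine ⟨(⋃ n, {q : ℝ × Ω | (q.1.toNNReal, q.2) ∈ G n} ∩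
    {q | δ⁻¹ • (pathPoint d c q.1 - X n q.2) ∈ C n q.2})ᶜ, ?_, ?_⟩
  · refine (MeasurableSet.iUnion fun n => MeasurableSet.inter ?_ ?_).compl
    · exact (measurable_real_toNNReal.comp measurable_fst).prodMk measurable_snd (hG n)
    · exact (((((measurable_pathPoint d c).comp measurable_fst).sub
        ((hm.poisson.measurable n).comp measurable_snd)).const_smul δ⁻¹).prodMk
        ((hm.shape_measurable n).comp measurable_snd)) measurableSet_mem_closeds
  · filter_upwards [ae_all_iff.2 hGY] with ω hω s
    rw [isCovered_iff hδ]
    simp only [Set.mem_compl_iff, Set.mem_iUnion, Set.mem_inter_iff, Set.mem_ofPred_eq, hω]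

end JointMeasurability

/-! ### Mean and variance of the measure of a random set. -/

section RandomIntegral

variable {S Ω : Type*} [MeasurableSpace S] [MeasurableSpace Ω] {P : Measure Ω}
  [IsProbabilityMeasure P] {μ : Measure S} [IsFiniteMeasure μ] {G : Set (S × Ω)}

theorem measurable_measureReal_slice (hG : MeasurableSet G) :
    Measurable fun ω => μ.real {s | (s, ω) ∈ G} :=
  (measurable_measure_prodMk_right hG).ennreal_toReal

theorem integral_measureReal_slice_swap (hG : MeasurableSet G) :
    ∫ ω, μ.real {s | (s, ω) ∈ G} ∂P = ∫ s, P.real {ω | (s, ω) ∈ G} ∂μ := by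
  simp only [measureReal_def]
  rw [integral_toReal (f := fun ω => μ {s | (s, ω) ∈ G}) (measurable_measure_prodMk_right hG).aemeasurable
    (ae_of_all _ fun _ => measure_lt_top _ _),
    integral_toReal (f := fun s => P {ω | (s, ω) ∈ G}) (measurable_measure_prodMk_left hG).aemeasurable
    (ae_of_all _ fun _ => measure_lt_top _ _)]
  exact congrArg ENNReal.toReal
    ((Measure.prod_apply_symm (μ := μ) (ν := P) hG).symm.trans (Measure.prod_apply hG))

/-- The variance of the measure of a random set as a double integral of covariances. -/
theorem variance_measureReal_slice (hG : MeasurableSet G) :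
    variance (fun ω => μ.real {s | (s, ω) ∈ G}) P =
      ∫ z : S × S, (P.real {ω | (z.1, ω) ∈ G ∧ (z.2, ω) ∈ G} -
        P.real {ω | (z.1, ω) ∈ G} * P.real {ω | (z.2, ω) ∈ G}) ∂(μ.prod μ) := by
  have hmem : MemLp (fun ω => μ.real {s | (s, ω) ∈ G}) 2 P := by
    refine MemLp.of_bound (measurable_measureReal_slice hG).aestronglyMeasurable (μ.real Set.univ)
      (ae_of_all _ fun ω => ?_)
    rw [Real.norm_eq_abs, abs_of_nonneg measureReal_nonneg]
    exact measureReal_mono (Set.subset_univ _)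
  have hG2 : MeasurableSet {q : (S × S) × Ω | (q.1.1, q.2) ∈ G ∧ (q.1.2, q.2) ∈ G} :=
    (((measurable_fst.comp measurable_fst).prodMk measurable_snd) hG).inter
      (((measurable_snd.comp measurable_fst).prodMk measurable_snd) hG)
  have hsq := integral_measureReal_slice_swap (P := P) (μ := μ.prod μ) hG2
  -- The squared measure of a slice is the product measure of the slice times itself, so the second
  -- moment is again an integral of probabilities.
  have hprod : ∀ ω, (μ.prod μ).real {z | (z, ω) ∈ {q : (S × S) × Ω |
      (q.1.1, q.2) ∈ G ∧ (q.1.2, q.2) ∈ G}} = μ.real {s | (s, ω) ∈ G} ^ 2 := by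
    intro ω
    rw [sq, ← measureReal_prod_prod]
    rfl
  simp_rw [hprod] at hsq
  have hm1 : Measurable fun s => P.real {ω | (s, ω) ∈ G} :=
    (measurable_measure_prodMk_left hG).ennreal_toReal
  have hm2 : Measurable fun z : S × S => P.real {ω | (z.1, ω) ∈ G ∧ (z.2, ω) ∈ G} :=
    (measurable_measure_prodMk_left hG2).ennreal_toReal
  have hb : ∀ A : Set Ω, ‖P.real A‖ ≤ 1 := fun A => by
    rw [Real.norm_eq_abs, abs_of_nonneg measureReal_nonneg]; exact measureReal_le_one
  rw [variance_eq_sub hmem, integral_sub]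
  · have : ∫ z : S × S, P.real {ω | (z.1, ω) ∈ G} * P.real {ω | (z.2, ω) ∈ G} ∂(μ.prod μ) =
        (∫ s, P.real {ω | (s, ω) ∈ G} ∂μ) * ∫ s, P.real {ω | (s, ω) ∈ G} ∂μ :=
      integral_prod_mul (fun s => P.real {ω | (s, ω) ∈ G}) fun s => P.real {ω | (s, ω) ∈ G}
    rw [this, ← sq, ← integral_measureReal_slice_swap hG]
    exact congrArg₂ _ hsq rfl
  · exact Integrable.of_bound hm2.aestronglyMeasurable 1 (ae_of_all _ fun z => hb _)
  · refine Integrable.of_bound ((hm1.comp measurable_fst).mul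
      (hm1.comp measurable_snd)).aestronglyMeasurable 1 (ae_of_all _ fun z => ?_)
    rw [norm_mul]
    exact mul_le_one₀ (hb _) (norm_nonneg _) (hb _)

end RandomIntegral

/-! ### Reduction of a double integral over a square to the time difference. -/

section Interval

theorem volume_real_Ioc_inter_shift (T v : ℝ) :
    volume.real {s | s ∈ Set.Ioc 0 T ∧ s + v ∈ Set.Ioc 0 T} = max (T - |v|) 0 := by
  have : {s | s ∈ Set.Ioc 0 T ∧ s + v ∈ Set.Ioc 0 T} = Set.Ioc (max 0 (-v)) (min T (T - v)) := by
    ext s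
    simp only [Set.mem_ofPred_eq, Set.mem_Ioc, max_lt_iff, le_min_iff]
    constructor
    · rintro ⟨⟨a, b⟩, c, d⟩
      exact ⟨⟨a, by linarith⟩, b, by linarith⟩
    · rintro ⟨⟨a, b⟩, c, d⟩
      exact ⟨⟨a, c⟩, by linarith, by linarith⟩
  rw [this, Real.volume_real_Ioc]
  congr 1
  rcases le_total 0 v with h | h
  · rw [abs_of_nonneg h, min_eq_right (by linarith), max_eq_left (by linarith)]; ring
  · rw [abs_of_nonpos h, min_eq_left (by linarith), max_eq_right (by linarith)]

/-- A double integral over a square of a function of the distance of the coordinates. -/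
theorem integral_prod_Ioc_comp_abs_sub (T : ℝ) {g : ℝ → ℝ} (hg : Measurable g)
    {M : ℝ} (hM : ∀ v, |g v| ≤ M) :
    ∫ z : ℝ × ℝ, g |z.2 - z.1| ∂((volume.restrict (Set.Ioc 0 T)).prod
      (volume.restrict (Set.Ioc 0 T))) = 2 * ∫ v in Set.Ioi 0, max (T - v) 0 * g v := by
  have hI : MeasurableSet (Set.Ioc (0 : ℝ) T) := measurableSet_Ioc
  -- The square in the coordinates `(s, v)` with `v = t - s`; its section at `v` has length `max (T
  -- - |v|) 0`.
  set D : Set (ℝ × ℝ) := {q | q.1 ∈ Set.Ioc 0 T ∧ q.1 + q.2 ∈ Set.Ioc 0 T} with hD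
  have hDm : MeasurableSet D :=
    (measurable_fst hI).inter ((measurable_fst.add measurable_snd) hI)
  have hM0 : 0 ≤ M := (abs_nonneg _).trans (hM 0)
  have hint : Integrable (D.indicator fun q : ℝ × ℝ => g |q.2|) (volume.prod volume) := by
    rw [integrable_indicator_iff hDm]
    refine Measure.integrableOn_of_bounded (M := M) ?_
      (hg.comp measurable_snd.abs).aestronglyMeasurable
      (ae_of_all _ fun q => hM _)
    refine measure_ne_top_of_subset (s := Set.Icc 0 T ×ˢ Set.Icc (-T) T) ?_
      ((isCompact_Icc.prod isCompact_Icc).measure_lt_top (μ := volume.prod volume)).ne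
    rintro ⟨s, v⟩ ⟨⟨a, b⟩, c, d⟩
    simp only [Set.mem_prod, Set.mem_Icc] at *
    exact ⟨⟨a.le, b⟩, by linarith, by linarith⟩
  have hsq : Integrable (fun z : ℝ × ℝ => g |z.2 - z.1|) ((volume.restrict (Set.Ioc 0 T)).prod
      (volume.restrict (Set.Ioc 0 T))) :=
    Integrable.of_bound (hg.comp (measurable_snd.sub measurable_fst).abs).aestronglyMeasurable M
      (ae_of_all _ fun z => hM _)
  have e1 : ∀ s, (Set.Ioc 0 T).indicator
      (fun s => ∫ t in Set.Ioc 0 T, g |t - s|) s =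
      ∫ v, D.indicator (fun q : ℝ × ℝ => g |q.2|) (s, v) := by
    intro s
    by_cases hs : s ∈ Set.Ioc 0 T
    · rw [Set.indicator_of_mem hs, ← integral_indicator hI, ← integral_add_left_eq_self _ s]
      refine integral_congr_ae (ae_of_all _ fun v => ?_)
      by_cases hv : s + v ∈ Set.Ioc 0 T
      · simp only [Set.indicator_of_mem hv, Set.indicator_of_mem (show (s, v) ∈ D from ⟨hs, hv⟩),
          add_sub_cancel_left]
      · simp only [Set.indicator_of_notMem hv,
          Set.indicator_of_notMem (show (s, v) ∉ D from fun h => hv h.2)]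
    · rw [Set.indicator_of_notMem hs]
      refine (integral_eq_zero_of_ae (ae_of_all _ fun v => ?_)).symm
      exact Set.indicator_of_notMem (show (s, v) ∉ D from fun h => hs h.1) _
  have e2 : ∀ v, ∫ s, D.indicator (fun q : ℝ × ℝ => g |q.2|) (s, v) =
      max (T - |v|) 0 * g |v| := by
    intro v
    have hm : MeasurableSet {s | s ∈ Set.Ioc 0 T ∧ s + v ∈ Set.Ioc 0 T} :=
      hI.inter (measurable_id.add_const v hI)
    have : (fun s => D.indicator (fun q : ℝ × ℝ => g |q.2|) (s, v)) =
        {s | s ∈ Set.Ioc 0 T ∧ s + v ∈ Set.Ioc 0 T}.indicator fun _ => g |v| := rfl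
    rw [this, integral_indicator hm, setIntegral_const, volume_real_Ioc_inter_shift, smul_eq_mul]
  rw [integral_prod _ hsq, ← integral_indicator hI]
  simp_rw [e1]
  rw [integral_integral_swap
    (f := fun s v => D.indicator (fun q : ℝ × ℝ => g |q.2|) (s, v)) hint]
  simp_rw [e2]
  exact integral_comp_abs (f := fun v => max (T - v) 0 * g v)

end Interval

/-! ### Measurability, bounds and support of the mean overlap. -/

section Overlap

variable {d : ℕ} (Q : Measure (Closeds (Space d)))

theorem measurable_meanOverlap [IsProbabilityMeasure Q] : Measurable (meanOverlap Q) := by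
  have hD : MeasurableSet {q : (Space d × Closeds (Space d)) × Space d |
      q.2 - q.1.1 ∈ q.1.2 ∧ q.2 ∈ q.1.2} :=
    ((measurable_snd.sub (measurable_fst.comp measurable_fst)).prodMk
        (measurable_snd.comp measurable_fst) measurableSet_mem_closeds).inter
      (measurable_snd.prodMk (measurable_snd.comp measurable_fst) measurableSet_mem_closeds)
  have h1 : Measurable fun q : Space d × Closeds (Space d) =>
      volume.real ((q.1 +ᵥ (q.2 : Set (Space d))) ∩ q.2) := by
    have e : (fun q : Space d × Closeds (Space d) =>
        volume.real ((q.1 +ᵥ (q.2 : Set (Space d))) ∩ q.2)) =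
        fun q => volume.real {y | (q, y) ∈ {q : (Space d × Closeds (Space d)) × Space d |
          q.2 - q.1.1 ∈ q.1.2 ∧ q.2 ∈ q.1.2}} := by
      funext q
      congr 1
      ext y
      simp only [Set.mem_inter_iff, Set.mem_vadd_set_iff_neg_vadd_mem, vadd_eq_add,
        neg_add_eq_sub, Set.mem_ofPred_eq, SetLike.mem_coe]
    rw [e]
    exact (measurable_measure_prodMk_left hD).ennreal_toReal
  exact (h1.stronglyMeasurable.integral_prod_right' (ν := Q)).measurable

theorem meanOverlap_nonneg (x : Space d) : 0 ≤ meanOverlap Q x :=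
  integral_nonneg fun _ => measureReal_nonneg

theorem meanVolume_nonneg : 0 ≤ meanVolume Q :=
  integral_nonneg fun _ => measureReal_nonneg

variable {Q} {τ : ℝ}

theorem meanOverlap_le [IsProbabilityMeasure Q]
    (hQ : ∀ᵐ F : Closeds (Space d) ∂Q, (F : Set (Space d)) ⊆ Metric.closedBall 0 τ) (x : Space d) :
    meanOverlap Q x ≤ volume.real (Metric.closedBall (0 : Space d) τ) := by
  have := integral_mono_of_nonneg (μ := Q)
    (f := fun F : Closeds (Space d) => volume.real ((x +ᵥ (F : Set (Space d))) ∩ F))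
    (g := fun _ => volume.real (Metric.closedBall (0 : Space d) τ))
    (ae_of_all _ fun _ => measureReal_nonneg) (integrable_const _) (by
      filter_upwards [hQ] with F hF
      exact measureReal_mono (Set.inter_subset_right.trans hF) measure_closedBall_lt_top.ne)
  rw [integral_const, probReal_univ, one_smul] at this
  exact this

theorem meanOverlap_eq_zero
    (hQ : ∀ᵐ F : Closeds (Space d) ∂Q, (F : Set (Space d)) ⊆ Metric.closedBall 0 τ) {x : Space d}
    (hx : 2 * τ < ‖x‖) : meanOverlap Q x = 0 := by
  refine integral_eq_zero_of_ae ?_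
  filter_upwards [hQ] with F hF
  have : (x +ᵥ (F : Set (Space d))) ∩ F = ∅ := by
    refine Set.eq_empty_of_forall_notMem fun y hy => ?_
    have h1 := hF (Set.mem_vadd_set_iff_neg_vadd_mem.1 hy.1)
    have h2 := hF hy.2
    rw [mem_closedBall_zero_iff] at h1 h2
    rw [vadd_eq_add] at h1
    have h3 := norm_sub_le y (-x + y)
    rw [show y - (-x + y) = x by abel] at h3
    linarith
  simp [this]

/-- By then the path has moved further than `2 * τ`, the diameter of the ball containing the shape.
This is the source of the cut-off `2 * τ / c` in the variance constant. -/
theorem meanOverlap_pathPoint_eq_zero [NeZero d]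
    (hQ : ∀ᵐ F : Closeds (Space d) ∂Q, (F : Set (Space d)) ⊆ Metric.closedBall 0 τ)
    {c v : ℝ} (hc : 0 < c) (hv : 2 * τ / c < v) :
    meanOverlap Q (pathPoint d c v) = 0 := by
  refine meanOverlap_eq_zero hQ ?_
  rw [norm_pathPoint]
  rw [div_lt_iff₀ hc] at hv
  exact hv.trans_le ((mul_comm v c).le.trans (le_abs_self _))

theorem measurable_meanOverlap_pathPoint [NeZero d] [IsProbabilityMeasure Q] (c : ℝ) :
    Measurable fun v => meanOverlap Q (pathPoint d c v) :=
  (measurable_meanOverlap Q).comp (measurable_pathPoint d c)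

end Overlap

/-! ### Exact mean and variance of the uncovered time. -/

section UncoveredTime

variable {d : ℕ} [NeZero d] {Ω : Type*} [MeasurableSpace Ω] {P : Measure Ω}
  {lam μ₀ μ₁ : ℝ} {Q : Measure (Closeds (Space d))}
  {X : ℕ → Ω → Space d} {C : ℕ → Ω → Closeds (Space d)} {Y : ℕ → ℝ≥0 → Ω → Fin 2}

/-- The uncovered time is, up to a null set, the length of a slice of a measurable set. -/
theorem IsMarkovPoissonBoolean.exists_slice (hm : IsMarkovPoissonBoolean P lam Q μ₀ μ₁ X C Y)
    {T : ℝ} (hT : 0 ≤ T) (c : ℝ) {δ : ℝ} (hδ : δ ≠ 0) :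
    ∃ G : Set (ℝ × Ω), MeasurableSet G ∧
      (∀ᵐ ω ∂P, IntervalIntegrable (fun s => 1 - coverIndicator c δ X C Y ω s) volume 0 T ∧
        uncoveredTime T c δ X C Y ω = (volume.restrict (Set.Ioc 0 T)).real {s | (s, ω) ∈ G}) ∧
      ∀ s t, P.real {ω | (s, ω) ∈ G ∧ (t, ω) ∈ G} =
        P.real {ω | ¬ IsCovered c δ X C Y ω s ∧ ¬ IsCovered c δ X C Y ω t} := by
  obtain ⟨G, hG, hGc⟩ := hm.exists_measurableSet_isCovered c hδ
  refine ⟨G, hG, ?_, fun s t => ?_⟩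
  · filter_upwards [hGc] with ω hω
    have hs : MeasurableSet {s | (s, ω) ∈ G} := measurable_prodMk_right hG
    have e : (fun s => 1 - coverIndicator c δ X C Y ω s) =
        {s | (s, ω) ∈ G}.indicator fun _ => (1 : ℝ) := by
      funext s
      by_cases h : IsCovered c δ X C Y ω s
      · rw [Set.indicator_of_notMem (show s ∉ {s | (s, ω) ∈ G} from fun h' => (hω s).1 h' h), coverIndicator, if_pos h, sub_self]
      · rw [Set.indicator_of_mem (show s ∈ {s | (s, ω) ∈ G} from (hω s).2 h), coverIndicator,
          if_neg h, sub_zero]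
    constructor
    · rw [e, intervalIntegrable_iff_integrableOn_Ioc_of_le hT]
      exact (integrable_const (1 : ℝ)).indicator hs
    · rw [uncoveredTime, e, intervalIntegral.integral_of_le hT, integral_indicator hs,
        setIntegral_const, smul_eq_mul, mul_one]
  · refine measureReal_congr ?_
    filter_upwards [hGc] with ω hω
    exact propext (and_congr (hω s) (hω t))

/-- The covariance of the vacancy indicators at two points of the path, as a function of their
time difference. Here `κ = δᵈ λ` and `p` is the stationary on-probability. -/
noncomputable def vacancyCov (Q : Measure (Closeds (Space d))) (c δ κ p γ u : ℝ) : ℝ :=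
  Real.exp (-(2 * p * κ * meanVolume Q)) *
    (Real.exp (p * κ * meanOverlap Q (pathPoint d c (δ⁻¹ * u)) *
      (p + (1 - p) * Real.exp (-(γ * |u|)))) - 1)

theorem measurable_vacancyCov [IsProbabilityMeasure Q] (c δ κ p γ : ℝ) :
    Measurable (vacancyCov Q c δ κ p γ) := by
  have h := (measurable_meanOverlap_pathPoint (Q := Q) c).comp (measurable_const_mul δ⁻¹)
  have h2 : Measurable fun u : ℝ => Real.exp (-(γ * |u|)) :=
    (measurable_id.abs.const_mul γ).neg.exp
  exact ((((h.const_mul (p * κ)).mul ((h2.const_mul (1 - p)).const_add p)).exp).sub_const 1).const_mul _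

/-- The prefactor is at most `1` and the inner exponent lies between `0` and `κ` times the volume of
the ball. The bound is uniform in `u`, `p` and `γ`, as domination requires. -/
theorem abs_vacancyCov_le [IsProbabilityMeasure Q] {τ : ℝ}
    (hQ : ∀ᵐ F : Closeds (Space d) ∂Q, (F : Set (Space d)) ⊆ Metric.closedBall 0 τ)
    (c δ : ℝ) {κ p γ : ℝ} (hκ : 0 ≤ κ) (hp0 : 0 ≤ p) (hp1 : p ≤ 1) (hγ : 0 ≤ γ) (u : ℝ) :
    |vacancyCov Q c δ κ p γ u| ≤
      Real.exp (κ * volume.real (Metric.closedBall (0 : Space d) τ)) := by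
  have h1 : Real.exp (-(2 * p * κ * meanVolume Q)) ≤ 1 :=
    Real.exp_le_one_iff.2 (neg_nonpos.2 (mul_nonneg (by positivity) (meanVolume_nonneg Q)))
  have hK0 := meanOverlap_nonneg Q (pathPoint d c (δ⁻¹ * u))
  have hK1 := meanOverlap_le hQ (pathPoint d c (δ⁻¹ * u))
  have hE : Real.exp (-(γ * |u|)) ≤ 1 := Real.exp_le_one_iff.2 (by
    have := mul_nonneg hγ (abs_nonneg u); linarith)
  have hE0 := (Real.exp_pos (-(γ * |u|))).le
  have hq0 : 0 ≤ p + (1 - p) * Real.exp (-(γ * |u|)) := by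
    have := mul_nonneg (sub_nonneg.2 hp1) hE0; linarith
  have hq1 : p + (1 - p) * Real.exp (-(γ * |u|)) ≤ 1 := by
    have := mul_le_mul_of_nonneg_left hE (sub_nonneg.2 hp1); linarith
  have hx0 : 0 ≤ p * κ * meanOverlap Q (pathPoint d c (δ⁻¹ * u)) *
      (p + (1 - p) * Real.exp (-(γ * |u|))) := by positivity
  have hx1 : p * κ * meanOverlap Q (pathPoint d c (δ⁻¹ * u)) *
      (p + (1 - p) * Real.exp (-(γ * |u|))) ≤
      κ * volume.real (Metric.closedBall (0 : Space d) τ) := by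
    refine (mul_le_of_le_one_right (by positivity) hq1).trans ?_
    rw [mul_assoc]
    exact (mul_le_of_le_one_left (by positivity) hp1).trans (by gcongr)
  have hge := Real.one_le_exp hx0
  rw [vacancyCov, abs_mul, abs_of_pos (Real.exp_pos _), abs_of_nonneg (sub_nonneg.2 hge)]
  refine (mul_le_of_le_one_left (sub_nonneg.2 hge) h1).trans ?_
  linarith [Real.exp_le_exp.2 hx1]

theorem onProb_mem {μ₀ μ₁ : ℝ} (h₀ : 0 ≤ μ₀) (h₁ : 0 ≤ μ₁) (hγ : 0 < μ₀ + μ₁) :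
    0 ≤ μ₀ / (μ₁ + μ₀) ∧ μ₀ / (μ₁ + μ₀) ≤ 1 :=
  ⟨by positivity, (div_le_one (by linarith)).2 (by linarith)⟩

variable [IsProbabilityMeasure P] [IsProbabilityMeasure Q]

theorem IsMarkovPoissonBoolean.moments_uncoveredTime
    (hm : IsMarkovPoissonBoolean P lam Q μ₀ μ₁ X C Y) (hlam : 0 ≤ lam)
    (h₀ : 0 ≤ μ₀) (h₁ : 0 ≤ μ₁) (hγ : 0 < μ₀ + μ₁) {τ : ℝ}
    (hQ : ∀ᵐ F : Closeds (Space d) ∂Q, (F : Set (Space d)) ⊆ Metric.closedBall 0 τ)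
    {T : ℝ} (hT : 0 ≤ T) (c : ℝ) {δ : ℝ} (hδ : 0 < δ) :
    AEMeasurable (uncoveredTime T c δ X C Y) P ∧
    (∀ᵐ ω ∂P, IntervalIntegrable (fun s => 1 - coverIndicator c δ X C Y ω s) volume 0 T) ∧
    (∀ᵐ ω ∂P, uncoveredTime T c δ X C Y ω ∈ Set.Icc 0 T) ∧
    ∫ ω, uncoveredTime T c δ X C Y ω ∂P =
      T * Real.exp (-(μ₀ / (μ₁ + μ₀) * (δ ^ d * lam) * meanVolume Q)) ∧
    variance (uncoveredTime T c δ X C Y) P =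
      δ * (2 * ∫ v in Set.Ioi 0, max (T - δ * v) 0 *
        vacancyCov Q c δ (δ ^ d * lam) (μ₀ / (μ₁ + μ₀)) (μ₀ + μ₁) (δ * v)) := by
  obtain ⟨G, hG, hGV, hGP⟩ := hm.exists_slice hT c hδ.ne'
  have hVe : uncoveredTime T c δ X C Y =ᵐ[P]
      fun ω => (volume.restrict (Set.Ioc 0 T)).real {s | (s, ω) ∈ G} := hGV.mono fun ω h => h.2
  have hpair := fun {s t : ℝ} (hs : 0 ≤ s) (hst : s ≤ t) =>
    (hGP s t).trans (hm.measureReal_not_isCovered hlam hγ hQ hδ c hs hst)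
  have hsingle : ∀ s, 0 ≤ s → P.real {ω | (s, ω) ∈ G} =
      Real.exp (-(μ₀ / (μ₁ + μ₀) * (δ ^ d * lam) * meanVolume Q)) := by
    intro s hs
    -- One-point vacancy is the pair formula at `t = s`, where the overlap becomes the volume.
    have h := hpair hs le_rfl
    simp only [and_self, sub_self, mul_zero, neg_zero, Real.exp_zero, mul_one,
      add_sub_cancel] at h
    rw [h, show pathPoint d c 0 = 0 by simp [pathPoint], meanOverlap_zero]
    congr 1
    ring
  have hcov : ∀ s t, 0 ≤ s → s ≤ t → P.real {ω | (s, ω) ∈ G ∧ (t, ω) ∈ G} -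
      P.real {ω | (s, ω) ∈ G} * P.real {ω | (t, ω) ∈ G} =
      vacancyCov Q c δ (δ ^ d * lam) (μ₀ / (μ₁ + μ₀)) (μ₀ + μ₁) (t - s) := by
    intro s t hs hst
    rw [hpair hs hst, hsingle s hs, hsingle t (hs.trans hst), ← Real.exp_add, vacancyCov,
      mul_sub_one, ← Real.exp_add, abs_of_nonneg (sub_nonneg.2 hst)]
    congr 2 <;> ring
  refine ⟨⟨_, measurable_measureReal_slice hG, hVe⟩, hGV.mono fun ω h => h.1, ?_, ?_, ?_⟩
  · filter_upwards [hVe] with ω hω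
    rw [hω]
    refine ⟨measureReal_nonneg, (measureReal_mono (Set.subset_univ _)).trans ?_⟩
    simp [hT]
  · rw [integral_congr_ae hVe, integral_measureReal_slice_swap hG,
      setIntegral_congr_fun measurableSet_Ioc (g := fun _ =>
        Real.exp (-(μ₀ / (μ₁ + μ₀) * (δ ^ d * lam) * meanVolume Q))) fun s hs => hsingle s hs.1.le,
      setIntegral_const, smul_eq_mul, Real.volume_real_Ioc_of_le hT, sub_zero]
  · rw [variance_congr hVe, variance_measureReal_slice hG]
    have hae : ∀ᵐ z : ℝ × ℝ ∂((volume.restrict (Set.Ioc 0 T)).prod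
        (volume.restrict (Set.Ioc 0 T))), P.real {ω | (z.1, ω) ∈ G ∧ (z.2, ω) ∈ G} -
          P.real {ω | (z.1, ω) ∈ G} * P.real {ω | (z.2, ω) ∈ G} =
        vacancyCov Q c δ (δ ^ d * lam) (μ₀ / (μ₁ + μ₀)) (μ₀ + μ₁) |z.2 - z.1| := by
      rw [Measure.prod_restrict]
      refine (ae_restrict_iff' (measurableSet_Ioc.prod measurableSet_Ioc)).2
        (ae_of_all _ fun z hz => ?_)
      rcases le_total z.1 z.2 with h | h
      · rw [abs_of_nonneg (sub_nonneg.2 h), hcov _ _ hz.1.1.le h]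
      · rw [abs_sub_comm, abs_of_nonneg (sub_nonneg.2 h), ← hcov _ _ hz.2.1.le h,
          mul_comm (P.real {ω | (z.1, ω) ∈ G})]
        simp only [and_comm]
    obtain ⟨hp0, hp1⟩ := onProb_mem h₀ h₁ hγ
    rw [integral_congr_ae hae, integral_prod_Ioc_comp_abs_sub T (measurable_vacancyCov _ _ _ _ _)
      (abs_vacancyCov_le hQ c δ (by positivity) hp0 hp1 hγ.le)]
    -- The substitution `u = δ v`, whose Jacobian is the factor `δ` of the variance.
    have := integral_comp_mul_left_Ioi (fun u => max (T - u) 0 *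
      vacancyCov Q c δ (δ ^ d * lam) (μ₀ / (μ₁ + μ₀)) (μ₀ + μ₁) u) 0 hδ
    rw [this, mul_zero, smul_eq_mul]
    field_simp

end UncoveredTime

/-! ### Moment bound and passage to the limit. -/

section Limits

/-- Both `V` and its mean lie in `[0, T]`, so `|V - m| ^ p ≤ T ^ (p - 1) * |V - m|`; the first
absolute moment is at most the standard deviation. -/
theorem integral_rpow_abs_sub_mean_le {Ω : Type*} [MeasurableSpace Ω] {P : Measure Ω}
    [IsProbabilityMeasure P] {V : Ω → ℝ} (hV : AEMeasurable V P) {T : ℝ}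
    (hVT : ∀ᵐ ω ∂P, V ω ∈ Set.Icc 0 T) {p : ℝ} (hp : 1 ≤ p) :
    ∫ ω, |V ω - ∫ ω', V ω' ∂P| ^ p ∂P ≤ T ^ (p - 1) * √(variance V P) := by
  set m := ∫ ω', V ω' ∂P
  have hVm : MemLp V ∞ P := memLp_top_of_bound hV.aestronglyMeasurable T (by
    filter_upwards [hVT] with ω h
    rw [Real.norm_eq_abs, abs_of_nonneg h.1]; exact h.2)
  have hm0 : 0 ≤ m := integral_nonneg_of_ae (hVT.mono fun ω h => h.1)
  have hmT : m ≤ T := by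
    have := integral_mono_ae (hVm.integrable le_top) (integrable_const T) (hVT.mono fun ω h => h.2)
    simpa using this
  have hW : MemLp (fun ω => |V ω - m|) ∞ P := (hVm.sub (memLp_const m)).norm
  have hW2 : MemLp (fun ω => |V ω - m|) 2 P := hW.mono_exponent le_top
  have hbd : ∀ᵐ ω ∂P, |V ω - m| ≤ T := hVT.mono fun ω h =>
    abs_le.2 ⟨by linarith [h.1], by linarith [h.2]⟩
  have hvar : (∫ ω, |V ω - m| ∂P) ≤ √(variance V P) := by
    refine Real.le_sqrt_of_sq_le ?_
    -- Nonnegativity of the variance of `|V - m|` is the inequality `(E |V - m|)² ≤ E (V - m)²`.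
    have h1 := variance_nonneg (fun ω => |V ω - m|) P
    rw [variance_eq_sub hW2] at h1
    rw [variance_eq_integral hV]
    have h2 : ∫ ω, ((fun ω => |V ω - m|) ^ 2) ω ∂P = ∫ ω, (V ω - m) ^ 2 ∂P :=
      integral_congr_ae (ae_of_all _ fun ω => sq_abs _)
    rw [h2] at h1
    linarith
  have hT : 0 ≤ T := hm0.trans hmT
  calc ∫ ω, |V ω - m| ^ p ∂P ≤ ∫ ω, T ^ (p - 1) * |V ω - m| ∂P := by
        refine integral_mono_of_nonneg (ae_of_all _ fun ω => by positivity)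
          ((hW.integrable le_top).const_mul _) ?_
        filter_upwards [hbd] with ω h
        have e := Real.rpow_add_one' (abs_nonneg (V ω - m)) (y := p - 1) (by linarith)
        rw [sub_add_cancel] at e
        change |V ω - m| ^ p ≤ _
        rw [e]
        exact mul_le_mul_of_nonneg_right (Real.rpow_le_rpow (abs_nonneg _) h (by linarith))
          (abs_nonneg _)
    _ = T ^ (p - 1) * ∫ ω, |V ω - m| ∂P := integral_const_mul _ _
    _ ≤ T ^ (p - 1) * √(variance V P) := by gcongr

/-- Positivity of `v` is essential when `a = ∞`: at `v = 0` the left side is constantly `1`. -/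
theorem tendsto_exp_decay {ι : Type*} {l : Filter ι} {r : ι → ℝ} (hr : ∀ i, 0 ≤ r i) {a : ℝ≥0∞}
    (h : Tendsto (fun i => ENNReal.ofReal (r i)) l (𝓝 a)) {v : ℝ} (hv : 0 < v) :
    Tendsto (fun i => Real.exp (-(r i * v))) l (𝓝 (decay a v)) := by
  by_cases ha : a = ∞
  · rw [decay, if_pos ha]
    rw [ha] at h
    exact Real.tendsto_exp_neg_atTop_nhds_zero.comp
      ((ENNReal.tendsto_ofReal_nhds_top.1 h).atTop_mul_const hv)
  · rw [decay, if_neg ha]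
    have h2 := (ENNReal.tendsto_toReal ha).comp h
    have h3 : Tendsto r l (𝓝 a.toReal) :=
      h2.congr fun i => ENNReal.toReal_ofReal (hr i)
    exact (Real.continuous_exp.tendsto _).comp (h3.mul_const v).neg

theorem tendsto_integral_vacancyCov {d : ℕ} [NeZero d] (Q : Measure (Closeds (Space d)))
    [IsProbabilityMeasure Q] {τ : ℝ} (hτ : 0 < τ)
    (hQ : ∀ᵐ F : Closeds (Space d) ∂Q, (F : Set (Space d)) ⊆ Metric.closedBall 0 τ)
    {T c : ℝ} (hT : 0 < T) (hc : 0 < c) {ι : Type*} {l : Filter ι} [l.IsCountablyGenerated]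
    {δ κ p γ : ι → ℝ} (hδ_pos : ∀ i, 0 < δ i) (hκ0 : ∀ i, 0 ≤ κ i)
    (hp0 : ∀ i, 0 ≤ p i) (hp1 : ∀ i, p i ≤ 1) (hγ : ∀ i, 0 ≤ γ i) (hδ : Tendsto δ l (𝓝 0))
    {ρ : ℝ} (hκ : Tendsto κ l (𝓝 ρ)) {a₀ : ℝ≥0∞}
    (ha₀ : Tendsto (fun i => ENNReal.ofReal (δ i * γ i)) l (𝓝 a₀))
    {p₁ : ℝ} (hp : Tendsto p l (𝓝 p₁)) :
    Tendsto (fun i => 2 * ∫ v in Set.Ioi 0, max (T - δ i * v) 0 *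
      vacancyCov Q c (δ i) (κ i) (p i) (γ i) (δ i * v)) l (𝓝 (limitVariance Q T c τ ρ p₁ a₀)) := by
  set v₀ := volume.real (Metric.closedBall (0 : Space d) τ)
  set f : ℝ → ℝ := fun v => T * (Real.exp (-(2 * p₁ * ρ * meanVolume Q)) *
    (Real.exp (p₁ * ρ * meanOverlap Q (pathPoint d c v) * (p₁ + (1 - p₁) * decay a₀ v)) - 1))
  have hlimit : limitVariance Q T c τ ρ p₁ a₀ = 2 * ∫ v in Set.Ioi 0, f v := by
    have hsub : Set.Ioc 0 (2 * τ / c) ⊆ Set.Ioi (0 : ℝ) := Set.Ioc_subset_Ioi_self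
    rw [setIntegral_eq_of_subset_of_forall_sdiff_eq_zero measurableSet_Ioi hsub]
    · rw [limitVariance, intervalIntegral.integral_of_le (by positivity), integral_const_mul,
        integral_const_mul]
      ring
    · intro v hv
      have h2 : 2 * τ / c < v := not_le.1 fun h => hv.2 ⟨hv.1, h⟩
      simp [f, meanOverlap_pathPoint_eq_zero hQ hc h2]
  rw [hlimit]
  refine Tendsto.const_mul 2 ?_
  refine tendsto_integral_filter_of_dominated_convergence
    -- Past `2 * τ / c` the overlap, and with it the covariance, vanishes; before it, `κ i < ρ + 1`
    -- holds eventually and the weight is at most `T`.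
    ((Set.Iic (2 * τ / c)).indicator fun _ => T * Real.exp ((ρ + 1) * v₀)) ?_ ?_ ?_ ?_
  · exact Eventually.of_forall fun i => ((((measurable_const_mul (δ i)).const_sub T).max
      measurable_const).mul ((measurable_vacancyCov _ _ _ _ _).comp
        (measurable_const_mul (δ i)))).aestronglyMeasurable
  · filter_upwards [hκ.eventually (Iio_mem_nhds (lt_add_one ρ))] with i hi
    refine (ae_restrict_iff' measurableSet_Ioi).2 (ae_of_all _ fun v hv => ?_)
    by_cases h : v ≤ 2 * τ / c
    · rw [Set.indicator_of_mem (show v ∈ Set.Iic (2 * τ / c) from h), norm_mul, Real.norm_eq_abs,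
        Real.norm_eq_abs, abs_of_nonneg (le_max_right _ _)]
      refine mul_le_mul (max_le ?_ hT.le) ((abs_vacancyCov_le hQ c (δ i) (hκ0 i) (hp0 i) (hp1 i)
        (hγ i) _).trans ?_) (abs_nonneg _) hT.le
      · have := mul_pos (hδ_pos i) hv
        linarith
      · refine Real.exp_le_exp.2 (mul_le_mul_of_nonneg_right (le_of_lt hi) measureReal_nonneg)
    · rw [Set.indicator_of_notMem (show v ∉ Set.Iic (2 * τ / c) from h), vacancyCov,
        inv_mul_cancel_left₀ (hδ_pos i).ne', meanOverlap_pathPoint_eq_zero hQ hc (not_le.1 h)]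
      simp
  · rw [integrable_indicator_iff measurableSet_Iic]
    refine integrableOn_const ?_
    rw [Measure.restrict_apply measurableSet_Iic, Set.Iic_inter_Ioi]
    exact measure_Ioc_lt_top.ne
  · refine (ae_restrict_iff' measurableSet_Ioi).2 (ae_of_all _ fun v hv => ?_)
    have hv' : 0 < v := hv
    have t1 : Tendsto (fun i => max (T - δ i * v) 0) l (𝓝 T) := by
      have := ((hδ.mul_const v).const_sub T).max (tendsto_const_nhds (x := (0 : ℝ)))
      simpa [hT.le] using this
    refine t1.mul ?_
    have t2 : Tendsto (fun i => Real.exp (-(γ i * |δ i * v|))) l (𝓝 (decay a₀ v)) := by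
      refine (tendsto_exp_decay (fun i => mul_nonneg (hδ_pos i).le (hγ i)) ha₀ hv').congr
        fun i => ?_
      rw [abs_of_pos (mul_pos (hδ_pos i) hv')]
      congr 1; ring
    -- The rescaling cancels inside the overlap, which no longer depends on `i`; only the parameters
    -- move.
    simp only [vacancyCov, inv_mul_cancel_left₀ (hδ_pos _).ne']
    have t3 := ((hp.const_mul 2).mul hκ).mul_const (meanVolume Q)
    have t4 := ((hp.mul hκ).mul_const (meanOverlap Q (pathPoint d c v))).mul
      (hp.add ((hp.const_sub 1).mul t2))
    exact ((Real.continuous_exp.tendsto _).comp t3.neg).mul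
      (((Real.continuous_exp.tendsto _).comp t4).sub_const 1)

end Limits

/-! ### The limit theorem. -/

theorem theorem6 {d : ℕ} [NeZero d]
    -- the law `Q` of the random closed shape `C`
    (Q : Measure (Closeds (Space d))) [IsProbabilityMeasure Q]
    (τ : ℝ) (hτ : 0 < τ)
    (hQ_ball : ∀ᵐ F : Closeds (Space d) ∂Q, (F : Set (Space d)) ⊆ Metric.closedBall 0 τ)
    (hQ_pos : ∀ᵐ F : Closeds (Space d) ∂Q, 0 < volume (F : Set (Space d)))
    -- duration and speed
    (T c : ℝ) (hT : 0 < T) (hc : 0 < c)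
    -- the limiting regime, along a general filter
    {ι : Type*} (l : Filter ι) [l.IsCountablyGenerated]
    (δ lam μ₀ μ₁ : ι → ℝ)
    (hδ_pos : ∀ i, 0 < δ i) (hlam_pos : ∀ i, 0 < lam i)
    (hμ₀ : ∀ i, 0 ≤ μ₀ i) (hμ₁ : ∀ i, 0 ≤ μ₁ i) (hγ : ∀ i, 0 < μ₀ i + μ₁ i)
    (hδ : Tendsto δ l (𝓝 0)) (hlam : Tendsto lam l atTop)
    (ρ : ℝ) (hρ_nonneg : 0 ≤ ρ) (hρ : Tendsto (fun i => δ i ^ d * lam i) l (𝓝 ρ))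
    (a₀ : ℝ≥0∞) (ha₀ : Tendsto (fun i => ENNReal.ofReal (δ i * (μ₀ i + μ₁ i))) l (𝓝 a₀))
    (p₁ : ℝ) (hp₁ : Tendsto (fun i => μ₀ i / (μ₁ i + μ₀ i)) l (𝓝 p₁))
    -- the models
    {Ω : ι → Type*} [∀ i, MeasurableSpace (Ω i)]
    (P : ∀ i, Measure (Ω i)) [∀ i, IsProbabilityMeasure (P i)]
    (X : ∀ i, ℕ → Ω i → Space d) (C : ∀ i, ℕ → Ω i → Closeds (Space d))
    (Y : ∀ i, ℕ → ℝ≥0 → Ω i → Fin 2)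
    (hmodel : ∀ i, IsMarkovPoissonBoolean (P i) (lam i) Q (μ₀ i) (μ₁ i) (X i) (C i) (Y i))
    (V : ∀ i, Ω i → ℝ) (hV : ∀ i, V i = uncoveredTime T c (δ i) (X i) (C i) (Y i)) :
    -- the uncovered time is a well-defined bounded random variable
    (∀ i, (∀ᵐ ω ∂P i, IntervalIntegrable
        (fun s => 1 - coverIndicator c (δ i) (X i) (C i) (Y i) ω s) volume 0 T) ∧
      MemLp (V i) ∞ (P i)) ∧
    -- convergence of the mean
    Tendsto (fun i => ∫ ω, V i ω ∂P i) l
      (𝓝 (T * Real.exp (-(p₁ * ρ * meanVolume Q)))) ∧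
    -- convergence to zero of the central absolute moments
    (∀ p : ℝ, 1 ≤ p →
      Tendsto (fun i => ∫ ω, |V i ω - ∫ ω', V i ω' ∂P i| ^ p ∂P i) l (𝓝 0)) ∧
    -- convergence of the rescaled variance
    Tendsto (fun i => (δ i)⁻¹ * variance (V i) (P i)) l
      (𝓝 (limitVariance Q T c τ ρ p₁ a₀)) := by
  have hmom := fun i => (hmodel i).moments_uncoveredTime (hlam_pos i).le (hμ₀ i) (hμ₁ i) (hγ i)
    hQ_ball hT.le c (hδ_pos i)
  simp only [← hV] at hmom
  have hvar : Tendsto (fun i => (δ i)⁻¹ * variance (V i) (P i)) l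
      (𝓝 (limitVariance Q T c τ ρ p₁ a₀)) := by
    refine (tendsto_integral_vacancyCov Q hτ hQ_ball hT hc hδ_pos
      (fun i => mul_nonneg (pow_nonneg (hδ_pos i).le d) (hlam_pos i).le)
      (fun i => (onProb_mem (hμ₀ i) (hμ₁ i) (hγ i)).1)
      (fun i => (onProb_mem (hμ₀ i) (hμ₁ i) (hγ i)).2)
      (fun i => (hγ i).le) hδ hρ ha₀ hp₁).congr fun i => ?_
    rw [(hmom i).2.2.2.2, inv_mul_cancel_left₀ (hδ_pos i).ne']
  -- The variance is `δ i` times a convergent quantity.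
  have hvar0 : Tendsto (fun i => variance (V i) (P i)) l (𝓝 0) := by
    have := hδ.mul hvar
    rw [zero_mul] at this
    exact this.congr fun i => mul_inv_cancel_left₀ (hδ_pos i).ne' _
  refine ⟨fun i => ⟨(hmom i).2.1, ?_⟩, ?_, fun p hp => ?_, hvar⟩
  · refine memLp_top_of_bound (hmom i).1.aestronglyMeasurable T ?_
    filter_upwards [(hmom i).2.2.1] with ω h
    rw [Real.norm_eq_abs, abs_of_nonneg h.1]
    exact h.2
  · simp_rw [fun i => (hmom i).2.2.2.1]
    exact ((Real.continuous_exp.tendsto _).comp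
      (((hp₁.mul hρ).mul_const (meanVolume Q)).neg)).const_mul T
  · refine squeeze_zero (fun i => integral_nonneg fun ω => by positivity)
      (fun i => integral_rpow_abs_sub_mean_le (hmom i).1 (hmom i).2.2.1 hp) ?_
    have := ((Real.continuous_sqrt.tendsto 0).comp hvar0).const_mul (T ^ (p - 1))
    simpa using this
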